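/- A polygon is a closed region $S$ of the plane bounded by a simple closed polygonal curve, no three consecutive vertices of which are collinear; it is called concave if it is not convex. A homothetic copy of $S$ is a set of the form $r\cdot S+p=\{rx+p : x\in S\}$ with $r>0$ and $p\in\mathbb{R}^2$. A collection of planar sets is an $m$-fold covering of the plane if every point of the plane is contained in at least $m$ members of the collection; a $1$-fold covering is simply called a covering. Theorem. Let $S$ be a convex polygon with at least four sides, or a concave polygon no two sides of which are parallel, and let $m>0$ be an integer. Then there is an $m$-fold covering of the plane by homothetic copies of $S$ that cannot be decomposed into two coverings, i.e. the collection is not the union of two disjoint subcollections each of which is itself a covering of the plane. -/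

import Mathlib

/-- The Euclidean plane. -/
abbrev Plane : Type := EuclideanSpace ℝ (Fin 2)

/-- A closed polygonal curve in the plane is a simple polygon with `n` sides if no three consecutive
vertices are collinear, the vertices are pairwise distinct, and two different sides have no point in
common except a common endpoint. -/
structure IsSimplePolygon {n : ℕ} [NeZero n] (P : Polygon Plane n) : Prop where
  nondegenerate : P.HasNondegenerateVertices ℝ
  injective : Function.Injective P.vertices
  edge_inter : ∀ i j : Fin n, i ≠ j →
    P.edgeSet ℝ i ∩ P.edgeSet ℝ j ⊆ {P i, P (i + 1)} ∩ {P j, P (j + 1)}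

/-- `S` is the (closed) polygon, as a region of the plane, whose boundary is the simple closed
polygonal curve `P`: the compact set that is the closure of its interior and whose topological
boundary is the union of the sides of `P`.  These conditions determine `S`: its interior is
open, bounded, nonempty, and closed in the complement of the curve, so it is the bounded component
of that complement. -/
structure IsPolygonWithBoundary {n : ℕ} [NeZero n] (S : Set Plane) (P : Polygon Plane n) :
    Prop where
  simple : IsSimplePolygon P
  isCompact : IsCompact S
  closure_interior : closure (interior S) = S
  frontier_eq : frontier S = P.boundary ℝ

/-- No two different sides lie on parallel (or equal) lines. -/
def HasNoParallelSides {n : ℕ} [NeZero n] (P : Polygon Plane n) : Prop :=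
  ∀ i j : Fin n, i ≠ j →
    ¬ (affineSpan ℝ {P i, P (i + 1)}).Parallel (affineSpan ℝ {P j, P (j + 1)})

/-- `C` is the image of `S` under the composition of a scaling with positive factor and a
translation. -/
def IsHomotheticCopy (S C : Set Plane) : Prop :=
  ∃ (r : ℝ) (p : Plane), 0 < r ∧ C = (fun x => r • x + p) '' S

/-- Every point of the plane lies in at least `m` members of the collection `𝒞`. -/
def IsFoldCovering (m : ℕ) (𝒞 : Set (Set Plane)) : Prop :=
  ∀ x : Plane, (m : ℕ∞) ≤ {C ∈ 𝒞 | x ∈ C}.encard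

/-- A covering is a `1`-fold covering. -/
def IsCovering (𝒞 : Set (Set Plane)) : Prop :=
  IsFoldCovering 1 𝒞

/-- The collection `𝒞` can be split into two disjoint parts, each of which is a covering. -/
def IsDecomposable (𝒞 : Set (Set Plane)) : Prop :=
  ∃ 𝒜 ℬ : Set (Set Plane), 𝒜 ∪ ℬ = 𝒞 ∧ Disjoint 𝒜 ℬ ∧ IsCovering 𝒜 ∧ IsCovering ℬ

/-! The covering encodes a finite hypergraph with no proper two-colouring. Its vertices are
homothetic copies of `S` very close to `S`; its edges are the sets of copies through certain points
near a corner `A` or a corner `C`. Every colouring leaves a point near `A` whose copies all have the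
first colour, or a point near `C` whose copies all have the second. Adding all copies that avoid
these finitely many points yields an `m`-fold covering in which these points are covered only by the
hypergraph copies, so one part of any splitting misses one of them
(`exists_indecomposable_of_isForcing`).

Near `A` and `C` the set looks like cones `W` and `Z`. After rescaling, a copy with parameter `t`
acts there as the translates `a t + W` and `b t + Z`, with `a`, `b` linear. The hypergraph is built
by double induction (`exists_isForcing`): a root joins the `A`-edges of one smaller family, shrunk
to a parameter `p`, and the `C`-edges of another, shrunk to `q`. This needs `a p` inside `W`, `a q`
outside `W` and the two translates incomparable, with the roles of `p` and `q` exchanged for `b` and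
`Z`.

Since `b t - a t` is a multiple of `C - A`, a parameter amounts to one common height transverse to
`C - A` and two free positions along it. Finding `p` and `q` becomes a choice of two heights suiting
both cones, possible unless `C - A` is along a side of each cone (`exists_heights`).

It remains to find two such corners on the boundary of the convex hull, where regularity makes `S`
locally a convex cone (`quadrant_dichotomy`). In a convex polygon with at least four sides the ends
of a diagonal serve. In a concave one, two nonadjacent extreme vertices of the hull serve: sides at
both ends along the joining line would be distinct and parallel. -/

open Filter Topology Set
open scoped Pointwise

/-! ### Hypergraphs without proper two-colourings from translates of two cones -/

section Tree

variable {T F : Type*} [AddCommGroup T] [Module ℝ T] [NormedAddCommGroup F] [NormedSpace ℝ F]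

/-- The parameters `t ∈ V` whose translate `a t + W` contains `x`. -/
def hits (a : T →ₗ[ℝ] F) (W : Set F) (V : Set T) (x : F) : Set T := {t ∈ V | x - a t ∈ W}

/-- `W` is invariant under scaling by positive factors. -/
def ScaleInvariant (W : Set F) : Prop := ∀ (δ : ℝ) (x : F), 0 < δ → (δ • x ∈ W ↔ x ∈ W)

theorem eventually_add_smul_mem {O : Set F} (hO : IsOpen O) {p : F} (hp : p ∈ O) (q : F) :
    ∀ᶠ δ : ℝ in 𝓝[>] 0, p + δ • q ∈ O := by
  have h : Tendsto (fun δ : ℝ => p + δ • q) (𝓝[>] 0) (𝓝 p) := by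
    have : Continuous fun δ : ℝ => p + δ • q := by fun_prop
    have h0 := this.tendsto 0
    simp only [zero_smul, add_zero] at h0
    exact h0.mono_left nhdsWithin_le_nhds
  exact h (hO.mem_nhds hp)

/-- The rescaled copy of `V` located near `s`. -/
def zoom (s : T) (δ : ℝ) (V : Set T) : Set T := (fun t => s + δ • t) '' V

theorem mem_zoom_hits {a : T →ₗ[ℝ] F} {W : Set F} (hW : ScaleInvariant W) {V : Set T} {s : T}
    {δ : ℝ} (hδ : 0 < δ) (x : F) :
    hits a W (zoom s δ V) (a s + δ • x) = zoom s δ (hits a W V x) := by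
  have key : ∀ t, a s + δ • x - a (s + δ • t) = δ • (x - a t) := by
    intro t
    simp only [map_add, map_smul, smul_sub]
    abel
  ext t
  constructor
  · rintro ⟨⟨t, ht, rfl⟩, h⟩
    refine ⟨t, ⟨ht, ?_⟩, rfl⟩
    simp only [key] at h
    exact (hW _ _ hδ).1 h
  · rintro ⟨t, ⟨ht, h⟩, rfl⟩
    refine ⟨⟨t, ht, rfl⟩, ?_⟩
    simp only [key]
    exact (hW _ _ hδ).2 h

theorem encard_zoom {δ : ℝ} (hδ : 0 < δ) (s : T) (V : Set T) :
    (zoom s δ V).encard = V.encard := by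
  apply Function.Injective.encard_image
  intro x y h
  have h' : δ • x = δ • y := add_left_cancel h
  exact smul_right_injective T hδ.ne' h'

theorem eventually_hits_zoom_eq_empty {a : T →ₗ[ℝ] F} {W : Set F} (hc : IsClosed W)
    {V : Set T} (hV : V.Finite) {s p : T} (hp : a p - a s ∉ W) (x : F) :
    ∀ᶠ δ : ℝ in 𝓝[>] 0, hits a W (zoom s δ V) (a p + δ • x) = ∅ := by
  have : ∀ t ∈ V, ∀ᶠ δ : ℝ in 𝓝[>] 0, (a p - a s) + δ • (x - a t) ∈ Wᶜ := fun t _ =>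
    eventually_add_smul_mem hc.isOpen_compl hp _
  filter_upwards [(hV.eventually_all).2 this] with δ h
  apply eq_empty_of_forall_notMem
  rintro _ ⟨⟨t, ht, rfl⟩, h'⟩
  apply h t ht
  convert h' using 1
  simp only [map_add, map_smul, smul_sub]
  abel

theorem hits_union (a : T →ₗ[ℝ] F) (W : Set F) (V V' : Set T) (x : F) :
    hits a W (V ∪ V') x = hits a W V x ∪ hits a W V' x := by
  ext t
  simp only [hits, mem_union, mem_ofPred_eq]
  tauto

theorem hits_singleton_zero_of_mem {a : T →ₗ[ℝ] F} {W : Set F} {x : F} (hx : x ∈ W) :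
    hits a W {0} x = {0} := by
  ext t
  simp only [hits, mem_singleton_iff, mem_ofPred_eq]
  exact ⟨fun h => h.1, fun h => ⟨h, by simpa [h] using hx⟩⟩

theorem hits_singleton_zero_of_notMem {a : T →ₗ[ℝ] F} {W : Set F} {x : F} (hx : x ∉ W) :
    hits a W {0} x = ∅ := by
  apply eq_empty_of_forall_notMem
  rintro t ⟨h, h'⟩
  rw [mem_singleton_iff] at h
  subst h
  simp only [map_zero, sub_zero] at h'
  exact hx h'

/-- Near `a p` a small zoomed family at `p`, the root `0` lying over it and a small zoomed family at
`q` out of the way are hit exactly as in the original family, together with the root. -/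
theorem eventually_hits_inner {a : T →ₗ[ℝ] F} {W : Set F} (hc : IsClosed W)
    (hW : ScaleInvariant W) {V V' : Set T} (hV' : V'.Finite) {p q : T}
    (hp : a p ∈ interior W) (hpq : a p - a q ∉ W) (x : F) :
    ∀ᶠ δ : ℝ in 𝓝[>] 0, hits a W ({0} ∪ (zoom p δ V ∪ zoom q δ V')) (a p + δ • x)
      = {0} ∪ zoom p δ (hits a W V x) := by
  filter_upwards [self_mem_nhdsWithin, eventually_hits_zoom_eq_empty hc hV' hpq x,
    eventually_add_smul_mem isOpen_interior hp x] with δ hδ h1 h2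
  rw [hits_union, hits_union, h1, mem_zoom_hits hW hδ,
    hits_singleton_zero_of_mem (interior_subset h2), union_empty]

/-- The same for a zoomed family that does not lie under the root. -/
theorem eventually_hits_outer {a : T →ₗ[ℝ] F} {W : Set F} (hc : IsClosed W)
    (hW : ScaleInvariant W) {V V' : Set T} (hV' : V'.Finite) {p q : T}
    (hp : a p ∉ W) (hpq : a p - a q ∉ W) (x : F) :
    ∀ᶠ δ : ℝ in 𝓝[>] 0, hits a W ({0} ∪ (zoom p δ V ∪ zoom q δ V')) (a p + δ • x)
      = zoom p δ (hits a W V x) := by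
  filter_upwards [self_mem_nhdsWithin, eventually_hits_zoom_eq_empty hc hV' hpq x,
    eventually_add_smul_mem hc.isOpen_compl hp x] with δ hδ h1 h2
  rw [hits_union, hits_union, h1, mem_zoom_hits hW hδ,
    hits_singleton_zero_of_notMem h2, union_empty, empty_union]

theorem eventually_zero_notMem_zoom {a : T →ₗ[ℝ] F} {V : Set T} (hV : V.Finite) {p : T}
    (hp : a p ≠ 0) : ∀ᶠ δ : ℝ in 𝓝[>] 0, (0 : T) ∉ zoom p δ V := by
  have : ∀ t ∈ V, ∀ᶠ δ : ℝ in 𝓝[>] 0, a p + δ • a t ∈ ({0} : Set F)ᶜ := fun t _ =>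
    eventually_add_smul_mem isOpen_compl_singleton hp _
  filter_upwards [(hV.eventually_all).2 this] with δ h
  rintro ⟨t, ht, h0⟩
  apply h t ht
  have := congrArg a h0
  simpa using this

/-- The finite families `V` (of parameters), `X` and `Y` (of points) realize a hypergraph without
proper two-colourings: every colouring of `V` has a point of `X` hit by one colour only or a point
of `Y` hit by the other colour only; the points of `X` and `Y` are hit at least `k` and `l` times. -/
structure IsForcing (a b : T →ₗ[ℝ] F) (W Z : Set F) (k l : ℕ) (V : Set T) (X Y : Set F) :
    Prop where
  finite : V.Finite
  finite_left : X.Finite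
  finite_right : Y.Finite
  card_left : ∀ x ∈ X, (k : ℕ∞) ≤ (hits a W V x).encard
  card_right : ∀ y ∈ Y, (l : ℕ∞) ≤ (hits b Z V y).encard
  forcing : ∀ c : T → Prop, (∃ x ∈ X, ∀ t ∈ hits a W V x, c t) ∨ (∃ y ∈ Y, ∀ t ∈ hits b Z V y, ¬ c t)

theorem card_inner {a : T →ₗ[ℝ] F} {W : Set F} {V : Set T} {p : T} {δ : ℝ} (hδ : 0 < δ) {x : F}
    {k : ℕ} (h0 : (0 : T) ∉ zoom p δ V) (hk : (k : ℕ∞) ≤ (hits a W V x).encard) :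
    ((k + 1 : ℕ) : ℕ∞) ≤ ({0} ∪ zoom p δ (hits a W V x)).encard := by
  have h0' : (0 : T) ∉ zoom p δ (hits a W V x) := fun h =>
    h0 (image_mono (fun t ht => ht.1) h)
  rw [singleton_union, encard_insert_of_notMem h0', encard_zoom hδ]
  push_cast
  gcongr

theorem exists_isForcing {a b : T →ₗ[ℝ] F} {W Z : Set F} (hWc : IsClosed W) (hZc : IsClosed Z)
    (hW : ScaleInvariant W) (hZ : ScaleInvariant Z) {p q : T}
    (hap : a p ∈ interior W) (haq : a q ∉ W) (hpq : a p - a q ∉ W) (hqp : a q - a p ∉ W)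
    (hbq : b q ∈ interior Z) (hbp : b p ∉ Z) (hpq' : b p - b q ∉ Z) (hqp' : b q - b p ∉ Z)
    (hp0 : a p ≠ 0) (hq0 : b q ≠ 0) (k l : ℕ) :
    ∃ V X Y, IsForcing a b W Z k l V X Y := by
  induction k generalizing l with
  | zero =>
    -- With `k = 0`, a point hit by nothing is vacuously of one colour.
    exact ⟨∅, {0}, ∅, finite_empty, finite_singleton 0, finite_empty, by simp, by simp,
      fun c => Or.inl ⟨0, rfl, fun t ht => ht.1.elim⟩⟩
  | succ k ihk =>
    induction l with
    | zero =>
      exact ⟨∅, ∅, {0}, finite_empty, finite_empty, finite_singleton 0, by simp, by simp,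
        fun c => Or.inr ⟨0, rfl, fun t ht => ht.1.elim⟩⟩
    | succ l ihl =>
      -- `V` goes near `p`, where the root raises the `X`-edges from `k` to `k + 1` and misses the
      -- `Y`-edges. `V'` goes near `q`, where the root raises the `Y'`-edges from `l` to `l + 1` and
      -- misses the `X'`-edges.
      obtain ⟨V, X, Y, h⟩ := ihk (l + 1)
      obtain ⟨V', X', Y', h'⟩ := ihl
      have e1 := (h.finite_left.eventually_all).2 fun x _ =>
        eventually_hits_inner (V := V) hWc hW h'.finite hap hpq x
      have e2 := (h'.finite_left.eventually_all).2 fun x _ =>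
        eventually_hits_outer (V := V') hWc hW h.finite haq hqp x
      have e3 := (h.finite_right.eventually_all).2 fun x _ =>
        eventually_hits_outer (V := V) hZc hZ h'.finite hbp hpq' x
      have e4 := (h'.finite_right.eventually_all).2 fun x _ =>
        eventually_hits_inner (V := V') hZc hZ h.finite hbq hqp' x
      obtain ⟨δ, hδ, e1, e2, e3, e4, e5, e6⟩ := (eventually_mem_nhdsWithin.and (e1.and (e2.and
        (e3.and (e4.and ((eventually_zero_notMem_zoom (a := a) h.finite hp0).and
          (eventually_zero_notMem_zoom (a := b) h'.finite hq0))))))).exists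
      have hδ : 0 < δ := hδ
      have comm : ({0} : Set T) ∪ (zoom p δ V ∪ zoom q δ V') =
        {0} ∪ (zoom q δ V' ∪ zoom p δ V) := by rw [union_comm (zoom p δ V)]
      rw [← comm] at e2 e4
      refine ⟨{0} ∪ (zoom p δ V ∪ zoom q δ V'),
        (fun x => a p + δ • x) '' X ∪ (fun x => a q + δ • x) '' X',
        (fun x => b p + δ • x) '' Y ∪ (fun x => b q + δ • x) '' Y', ?_, ?_, ?_, ?_, ?_, ?_⟩
      · exact (finite_singleton 0).union ((h.finite.image _).union (h'.finite.image _))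
      · exact (h.finite_left.image _).union (h'.finite_left.image _)
      · exact (h.finite_right.image _).union (h'.finite_right.image _)
      · rintro _ (⟨x, hx, rfl⟩ | ⟨x, hx, rfl⟩)
        · simp only [e1 x hx]
          exact card_inner hδ e5 (h.card_left x hx)
        · simp only [e2 x hx]
          rw [encard_zoom hδ]
          exact h'.card_left x hx
      · rintro _ (⟨x, hx, rfl⟩ | ⟨x, hx, rfl⟩)
        · simp only [e3 x hx]
          rw [encard_zoom hδ]
          exact h.card_right x hx
        · simp only [e4 x hx]
          exact card_inner hδ e6 (h'.card_right x hx)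
      · intro c
        -- The colour of the root selects the subfamily whose enlarged edges it keeps monochromatic.
        by_cases c0 : c 0
        · rcases h.forcing fun t => c (p + δ • t) with ⟨x, hx, hc⟩ | ⟨x, hx, hc⟩
          · refine Or.inl ⟨_, Or.inl ⟨x, hx, rfl⟩, ?_⟩
            simp only [e1 x hx]
            rintro t (rfl | ⟨t, ht, rfl⟩)
            exacts [c0, hc t ht]
          · refine Or.inr ⟨_, Or.inl ⟨x, hx, rfl⟩, ?_⟩
            simp only [e3 x hx]
            rintro t ⟨t, ht, rfl⟩
            exact hc t ht
        · rcases h'.forcing fun t => c (q + δ • t) with ⟨x, hx, hc⟩ | ⟨x, hx, hc⟩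
          · refine Or.inl ⟨_, Or.inr ⟨x, hx, rfl⟩, ?_⟩
            simp only [e2 x hx]
            rintro t ⟨t, ht, rfl⟩
            exact hc t ht
          · refine Or.inr ⟨_, Or.inr ⟨x, hx, rfl⟩, ?_⟩
            simp only [e4 x hx]
            rintro t (rfl | ⟨t, ht, rfl⟩)
            exacts [c0, hc t ht]

end Tree

/-! ### From a forcing family to an indecomposable covering -/

section Copies

/-- The homothetic copy of `S` with ratio `t.1` and translation vector `t.2`. -/
def homothet (S : Set Plane) (t : ℝ × Plane) : Set Plane := (fun x => t.1 • x + t.2) '' S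

theorem mem_homothet_iff {S : Set Plane} {t : ℝ × Plane} (ht : 0 < t.1) {y : Plane} :
    y ∈ homothet S t ↔ t.1⁻¹ • (y - t.2) ∈ S := by
  constructor
  · rintro ⟨x, hx, rfl⟩
    simpa [smul_smul, inv_mul_cancel₀ ht.ne'] using hx
  · intro h
    exact ⟨_, h, by simp [smul_smul, mul_inv_cancel₀ ht.ne']⟩

theorem isHomotheticCopy_homothet (S : Set Plane) {t : ℝ × Plane} (ht : 0 < t.1) :
    IsHomotheticCopy S (homothet S t) := ⟨t.1, t.2, ht, rfl⟩

theorem diam_homothet (S : Set Plane) {t : ℝ × Plane} (ht : 0 < t.1) :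
    Metric.diam (homothet S t) = t.1 * Metric.diam S := by
  have h : homothet S t = (fun x => x + t.2) '' (t.1 • S) := by
    ext x
    simp [homothet, mem_smul_set, ← sub_eq_add_neg, eq_sub_iff_add_eq]
  rw [h, (isometry_add_right t.2).diam_image, diam_smul₀, Real.norm_of_nonneg ht.le]

/-- The diameter determines the ratio, and a compact set differs from its nonzero translates, as
maximizing the inner product with the translation vector shows. Needed because a collection is a set
of sets, so distinct parameters must give distinct members. -/
theorem homothet_injOn {S : Set Plane} (hS : IsCompact S) (hS' : S.Nontrivial) :
    InjOn (homothet S) {t | 0 < t.1} := by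
  rintro ⟨r, p⟩ hr ⟨r', p'⟩ hr' h
  simp only [mem_ofPred_eq] at hr hr'
  have hd : 0 < Metric.diam S := Metric.diam_pos hS' hS.isBounded
  have h1 : r * Metric.diam S = r' * Metric.diam S := by
    rw [← diam_homothet S (t := (r, p)) hr, ← diam_homothet S (t := (r', p')) hr', h]
  obtain rfl : r = r' := mul_right_cancel₀ hd.ne' h1
  obtain ⟨s, hs, hmax⟩ := hS.exists_isMaxOn hS'.nonempty
    (f := fun x : Plane => inner ℝ (p - p') x) (by fun_prop)
  have hm : r • s + p ∈ homothet S (r, p') := h ▸ ⟨s, hs, rfl⟩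
  obtain ⟨s', hs', e⟩ := hm
  have e' : r • s' = r • s + (p - p') := by
    simp only at e
    rw [← sub_eq_iff_eq_add.2 e.symm]
    abel_nf
  have e2 := congrArg (fun x : Plane => inner ℝ (p - p') x) e'
  simp only [inner_add_right, inner_smul_right, real_inner_self_eq_norm_sq] at e2
  have h3 : inner ℝ (p - p') s' ≤ inner ℝ (p - p') s := hmax hs'
  have h4 : ‖p - p'‖ ^ 2 ≤ 0 := by nlinarith
  have h5 : p - p' = 0 := by
    rw [← norm_eq_zero]
    exact pow_eq_zero_iff two_ne_zero |>.1 (le_antisymm h4 (sq_nonneg _))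
  rw [sub_eq_zero.1 h5]

/-- A point outside a closed set lies in infinitely many homothetic copies of `S` that avoid the
closed set. -/
theorem infinite_homothetic_copies {S : Set Plane} (hS : IsCompact S) (hS' : S.Nontrivial)
    {Q : Set Plane} (hQ : IsClosed Q) {z : Plane} (hz : z ∉ Q) :
    {C | (IsHomotheticCopy S C ∧ Disjoint C Q) ∧ z ∈ C}.Infinite := by
  obtain ⟨s, hs⟩ := hS'.nonempty
  obtain ⟨ε, hε, hball⟩ := Metric.isOpen_iff.1 hQ.isOpen_compl z hz
  obtain ⟨R, hR⟩ := hS.isBounded.subset_ball s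
  have hR0 : 0 < R := by simpa using hR hs
  have hη : 0 < ε / R := div_pos hε hR0
  have hinj : InjOn (fun r : ℝ => homothet S (r, z - r • s)) (Ioo 0 (ε / R)) := by
    intro r hr r' hr' h
    exact congrArg Prod.fst (homothet_injOn hS hS' (x₁ := (r, z - r • s))
      (x₂ := (r', z - r' • s)) hr.1 hr'.1 h)
  refine ((Ioo_infinite hη).image hinj).mono ?_
  rintro _ ⟨r, hr, rfl⟩
  refine ⟨⟨isHomotheticCopy_homothet S hr.1, ?_⟩, s, hs, by simp⟩
  rw [disjoint_left]
  rintro _ ⟨x, hx, rfl⟩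
  apply hball
  have hx' : ‖x - s‖ < R := by simpa [dist_eq_norm] using hR hx
  rw [Metric.mem_ball, dist_eq_norm]
  have : r • x + (z - r • s) - z = r • (x - s) := by
    rw [smul_sub]
    abel
  simp only [this, norm_smul, Real.norm_of_nonneg hr.1.le]
  calc r * ‖x - s‖ ≤ r * R := by gcongr; exact hr.1.le
    _ < ε / R * R := by
      have := hr.2
      gcongr
    _ = ε := by field_simp

/-- The image of the point `A` under the homothety with parameters `t`, as a linear map in `t`. -/
noncomputable def cornerMap (A : Plane) : ℝ × Plane →ₗ[ℝ] Plane :=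
  (LinearMap.fst ℝ ℝ Plane).smulRight A + LinearMap.snd ℝ ℝ Plane

theorem cornerMap_apply (A : Plane) (t : ℝ × Plane) : cornerMap A t = t.1 • A + t.2 := rfl

/-- The parameters of a homothety close to the identity, in direction `t`. -/
noncomputable def nearIdentity (δ : ℝ) (t : ℝ × Plane) : ℝ × Plane := (1 + δ * t.1, δ • t.2)

theorem nearIdentity_injective {δ : ℝ} (hδ : 0 < δ) : Function.Injective (nearIdentity δ) := by
  rintro ⟨r, p⟩ ⟨r', p'⟩ h
  simp only [nearIdentity, Prod.mk.injEq] at h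
  have h1 : r = r' := mul_left_cancel₀ hδ.ne' (add_left_cancel h.1)
  have h2 : p = p' := smul_right_injective _ hδ.ne' h.2
  rw [h1, h2]

theorem eventually_nearIdentity_pos (t : ℝ × Plane) :
    ∀ᶠ δ : ℝ in 𝓝[>] 0, 0 < (nearIdentity δ t).1 := by
  filter_upwards [eventually_add_smul_mem (F := ℝ) (isOpen_Ioi (a := (0 : ℝ)))
    (p := (1 : ℝ)) (by simp) t.1]
    with δ h
  simpa [nearIdentity] using h

/-- Pulling `A + δ • x` back by the homothety gives `A` plus a positive multiple of `x - cornerMap A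
t`, tending to `A`; scale invariance removes the factor. -/
theorem eventually_mem_homothet_iff {S : Set Plane} {A : Plane} {W : Set Plane}
    (hW : ScaleInvariant W) (hA : ∀ᶠ x in 𝓝 A, x ∈ S ↔ x - A ∈ W) (t : ℝ × Plane) (x : Plane) :
    ∀ᶠ δ : ℝ in 𝓝[>] 0,
      (A + δ • x ∈ homothet S (nearIdentity δ t) ↔ x - cornerMap A t ∈ W) := by
  have hc : Tendsto (fun δ : ℝ => (1 + δ * t.1)⁻¹ • (A + δ • x - δ • t.2)) (𝓝[>] 0) (𝓝 A) := by
    have h : ContinuousAt (fun δ : ℝ => (1 + δ * t.1)⁻¹ • (A + δ • x - δ • t.2)) 0 := by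
      refine ContinuousAt.fun_smul ?_ ?_
      · exact ContinuousAt.inv₀ (by fun_prop) (by simp)
      · fun_prop
    have h' := h.tendsto
    simp only [zero_mul, add_zero, inv_one, zero_smul, sub_zero, one_smul] at h'
    exact h'.mono_left nhdsWithin_le_nhds
  filter_upwards [hc.eventually hA, eventually_nearIdentity_pos t, self_mem_nhdsWithin]
    with δ h hpos hδ
  rw [mem_homothet_iff hpos]
  have hpos' : 0 < 1 + δ * t.1 := hpos
  have hδ' : (0 : ℝ) < δ := hδ
  simp only [nearIdentity]
  have e : (1 + δ * t.1)⁻¹ • (A + δ • x - δ • t.2) - A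
      = ((1 + δ * t.1)⁻¹ * δ) • (x - cornerMap A t) := by
    have : A = (1 + δ * t.1)⁻¹ • ((1 + δ * t.1) • A) := by
      rw [smul_smul, inv_mul_cancel₀ hpos'.ne', one_smul]
    nth_rewrite 2 [this]
    rw [← smul_sub, mul_smul, cornerMap_apply]
    congr 1
    module
  rw [h, e, hW _ _ (by positivity)]

/-- If `S` looks like the cone `W` near `A` and like the cone `Z` near `C`, and a non-two-colourable
hypergraph is realized by translates of these cones, then there is an `m`-fold covering by
homothetic copies of `S` that does not split into two coverings. -/
theorem exists_indecomposable_of_isForcing {S : Set Plane} (hS : IsCompact S)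
    (hS' : S.Nontrivial) {A C : Plane} {W Z : Set Plane}
    (hW : ScaleInvariant W) (hZ : ScaleInvariant Z)
    (hA : ∀ᶠ x in 𝓝 A, x ∈ S ↔ x - A ∈ W) (hC : ∀ᶠ x in 𝓝 C, x ∈ S ↔ x - C ∈ Z)
    {m : ℕ} {V : Set (ℝ × Plane)} {X Y : Set Plane}
    (h : IsForcing (cornerMap A) (cornerMap C) W Z m m V X Y) :
    ∃ 𝒞 : Set (Set Plane),
      (∀ D ∈ 𝒞, IsHomotheticCopy S D) ∧ IsFoldCovering m 𝒞 ∧ ¬ IsDecomposable 𝒞 := by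
  have e1 := (h.finite.eventually_all).2 fun t _ => eventually_nearIdentity_pos t
  have e2 := (h.finite_left.eventually_all).2 fun x _ => (h.finite.eventually_all).2 fun t _ =>
    eventually_mem_homothet_iff hW hA t x
  have e3 := (h.finite_right.eventually_all).2 fun x _ => (h.finite.eventually_all).2 fun t _ =>
    eventually_mem_homothet_iff hZ hC t x
  obtain ⟨δ, hδ, e1, e2, e3⟩ :=
    (eventually_mem_nhdsWithin.and (e1.and (e2.and e3))).exists
  have hδ : 0 < δ := hδ
  set f : ℝ × Plane → Set Plane := fun t => homothet S (nearIdentity δ t) with hf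
  have hfinj : InjOn f V := by
    intro t ht t' ht' e
    exact nearIdentity_injective hδ (homothet_injOn hS hS' (e1 t ht) (e1 t' ht') e)
  set Q : Set Plane := (fun x => A + δ • x) '' X ∪ (fun x => C + δ • x) '' Y with hQ
  have hQc : IsClosed Q := ((h.finite_left.image _).union (h.finite_right.image _)).isClosed
  -- The copies disjoint from `Q` cover everything else infinitely often and leave the edges of the
  -- hypergraph unchanged.
  set 𝒞 : Set (Set Plane) := f '' V ∪ {D | IsHomotheticCopy S D ∧ Disjoint D Q} with h𝒞
  have count : ∀ H ⊆ V, ∀ z : Plane, (∀ t ∈ H, z ∈ f t) → (m : ℕ∞) ≤ H.encard →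
      (m : ℕ∞) ≤ {D ∈ 𝒞 | z ∈ D}.encard := by
    intro H hH z hz hm
    rw [← (hfinj.mono hH).encard_image] at hm
    refine hm.trans (encard_le_encard ?_)
    rintro _ ⟨t, ht, rfl⟩
    exact ⟨Or.inl ⟨t, hH ht, rfl⟩, hz t ht⟩
  refine ⟨𝒞, ?_, ?_, ?_⟩
  · rintro D (⟨t, ht, rfl⟩ | hD)
    exacts [isHomotheticCopy_homothet S (e1 t ht), hD.1]
  · intro z
    by_cases hz : z ∈ Q
    · rcases hz with ⟨x, hx, rfl⟩ | ⟨x, hx, rfl⟩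
      · exact count _ (fun t ht => ht.1) _ (fun t ht => (e2 x hx t ht.1).2 ht.2)
          (h.card_left x hx)
      · exact count _ (fun t ht => ht.1) _ (fun t ht => (e3 x hx t ht.1).2 ht.2)
          (h.card_right x hx)
    · have hinf : {D ∈ 𝒞 | z ∈ D}.Infinite :=
        (infinite_homothetic_copies hS hS' hQc hz).mono fun D hD => ⟨Or.inr hD.1, hD.2⟩
      rw [hinf.encard_eq]
      exact le_top
  · rintro ⟨𝒜, ℬ, hAB, hdis, hA', hB'⟩
    have member : ∀ 𝒟 ⊆ 𝒞, IsCovering 𝒟 → ∀ z ∈ Q, ∃ t ∈ V, f t ∈ 𝒟 ∧ z ∈ f t := by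
      intro 𝒟 h𝒟 hcov z hz
      have h1 := hcov z
      rw [Nat.cast_one, one_le_encard_iff_nonempty] at h1
      obtain ⟨D, hD, hzD⟩ := h1
      rcases h𝒟 hD with ⟨t, ht, rfl⟩ | hD'
      · exact ⟨t, ht, hD, hzD⟩
      · exact absurd hz (disjoint_left.1 hD'.2 hzD)
    rcases h.forcing fun t => f t ∈ 𝒜 with ⟨x, hx, hc⟩ | ⟨x, hx, hc⟩
    · obtain ⟨t, ht, htB, hmem⟩ := member ℬ (hAB ▸ subset_union_right) hB' _
        (Or.inl ⟨x, hx, rfl⟩)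
      exact disjoint_left.1 hdis (hc t ⟨ht, (e2 x hx t ht).1 hmem⟩) htB
    · obtain ⟨t, ht, htA, hmem⟩ := member 𝒜 (hAB ▸ subset_union_left) hA' _
        (Or.inr ⟨x, hx, rfl⟩)
      exact hc t ⟨ht, (e3 x hx t ht).1 hmem⟩ htA

end Copies

/-! ### Choosing the parameters `p` and `q` for two convex cones -/

section Directions

/-- The point `(p, q)` is interior to the nonnegative quadrant, `(p', q')` is outside, and the two
points are incomparable. -/
def Separated (p q p' q' : ℝ) : Prop :=
  (p' < 0 ∧ 0 < p ∧ 0 < q ∧ q < q') ∨ (q' < 0 ∧ 0 < q ∧ 0 < p ∧ p < p')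

theorem Separated.swap {p q p' q' : ℝ} (h : Separated p q p' q') : Separated q p q' p' := Or.symm h

/-- The lines parallel to `(a, b)` at the heights `s` and `s'` carry separated points. -/
def Feasible (a b s s' : ℝ) : Prop :=
  ∃ p q p' q' : ℝ, a * q - b * p = s ∧ a * q' - b * p' = s' ∧ Separated p q p' q'

theorem Feasible.swap {a b s s' : ℝ} (h : Feasible b a (-s) (-s')) : Feasible a b s s' := by
  obtain ⟨p, q, p', q', h1, h2, h3⟩ := h
  exact ⟨q, p, q', p', by linarith, by linarith, h3.swap⟩

theorem Feasible.neg {a b s s' : ℝ} (h : Feasible (-a) (-b) (-s) (-s')) : Feasible a b s s' := by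
  obtain ⟨p, q, p', q', h1, h2, h3⟩ := h
  exact ⟨p, q, p', q', by linarith, by linarith, h3⟩

theorem feasible_of_pos_of_pos {a b s s' : ℝ} (ha : 0 < a) (hb : 0 < b) (hs : 0 < s)
    (hs' : s' < 0) : Feasible a b s s' := by
  have hε : 0 < -s' / (4 * b) := by
    apply div_pos <;> linarith
  have e : b * (-s' / (4 * b)) = -s' / 4 := by field_simp
  set ε := -s' / (4 * b)
  -- This `ε` makes `s' + b * (2 * ε) = s' / 2`, still negative, so the second point remains below
  -- the quadrant while lying to the right of the first.
  refine ⟨ε, (s + b * ε) / a, 2 * ε, (s' + b * (2 * ε)) / a, by field_simp; ring,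
    by field_simp; ring, Or.inr ⟨?_, ?_, hε, by linarith⟩⟩
  · apply div_neg_of_neg_of_pos _ ha
    linarith
  · positivity

theorem feasible_of_mul_pos {a b s s' : ℝ} (hab : 0 < a * b) (hs : s * s' < 0) :
    Feasible a b s s' := by
  rcases pos_and_pos_or_neg_and_neg_of_mul_pos hab with ⟨ha, hb⟩ | ⟨ha, hb⟩ <;>
    rcases mul_neg_iff.1 hs with ⟨h1, h2⟩ | ⟨h1, h2⟩
  · exact feasible_of_pos_of_pos ha hb h1 h2
  · exact (feasible_of_pos_of_pos hb ha (by linarith) (by linarith)).swap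
  · apply Feasible.neg
    exact (feasible_of_pos_of_pos (by linarith) (by linarith) (by linarith) (by linarith)).swap
  · apply Feasible.neg
    exact feasible_of_pos_of_pos (by linarith) (by linarith) (by linarith) (by linarith)

theorem feasible_of_pos_of_neg {a b s : ℝ} (ha : 0 < a) (hb : b < 0) (hs : 0 < s) (s' : ℝ) :
    Feasible a b s s' := by
  obtain ⟨c, hc, rfl⟩ : ∃ c : ℝ, 0 < c ∧ b = -c := ⟨-b, by linarith, by ring⟩
  -- With this `K`, the ordinate `(s' + c * K) / a` is at least `s / a`, hence above `s / (2 * a)`.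
  have hK : 0 < (|s'| + s) / c := by positivity
  have e : c * ((|s'| + s) / c) = |s'| + s := by field_simp
  set K := (|s'| + s) / c
  refine ⟨s / (2 * c), s / (2 * a), -K, (s' + c * K) / a, by field_simp; ring,
    by field_simp; ring, Or.inl ⟨by linarith, by positivity, by positivity, ?_⟩⟩
  rw [div_lt_div_iff₀ (by positivity) ha, e]
  have := neg_abs_le s'
  nlinarith

theorem exists_feasible_of_mul_neg {a b : ℝ} (hab : a * b < 0) :
    ∃ σ : ℝ, |σ| = 1 ∧ ∀ κ > 0, ∀ s', Feasible a b (σ * κ) s' := by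
  rcases mul_neg_iff.1 hab with ⟨ha, hb⟩ | ⟨ha, hb⟩
  · exact ⟨1, by simp, fun κ hκ s' => feasible_of_pos_of_neg ha hb (by linarith) s'⟩
  · exact ⟨-1, by simp, fun κ hκ s' =>
      (feasible_of_pos_of_neg hb ha (by linarith) (-s')).swap⟩

/-- The lines are vertical, so the heights fix the abscissas. Doubling the absolute value puts the
second line either at a negative abscissa or strictly to the right of the first; both allow
separated points. -/
theorem exists_feasible_of_eq_zero {b : ℝ} (hb : b ≠ 0) :
    ∃ σ : ℝ, |σ| = 1 ∧ ∀ κ > 0, ∀ s', |s'| = 2 * κ → Feasible 0 b (σ * κ) s' := by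
  have main : ∀ b : ℝ, 0 < b → ∀ κ > 0, ∀ s', |s'| = 2 * κ → Feasible 0 b (-1 * κ) s' := by
    intro b hb κ hκ s' hs'
    rcases eq_or_eq_neg_of_abs_eq hs' with rfl | rfl
    · refine ⟨κ / b, 1, -(2 * κ / b), 2, by field_simp; ring, by field_simp; ring,
        Or.inl ⟨by simp; positivity, by positivity, by norm_num, by norm_num⟩⟩
    · refine ⟨κ / b, 1, 2 * κ / b, -1, by field_simp; ring, by field_simp; ring,
        Or.inr ⟨by norm_num, by norm_num, by positivity, ?_⟩⟩
      gcongr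
      linarith
  rcases lt_or_gt_of_ne hb with hb | hb
  · refine ⟨1, by simp, fun κ hκ s' hs' => Feasible.neg ?_⟩
    have := main (-b) (by linarith) κ hκ (-s') (by simpa using hs')
    simpa using this
  · exact ⟨-1, by simp, main b hb⟩

theorem exists_feasible_of_mul_nonpos {a b : ℝ} (hab : a * b ≤ 0) (h0 : a ≠ 0 ∨ b ≠ 0) :
    ∃ σ : ℝ, |σ| = 1 ∧ ∀ κ > 0, ∀ s', |s'| = 2 * κ → Feasible a b (σ * κ) s' := by
  rcases hab.lt_or_eq with hab | hab
  · obtain ⟨σ, h1, h2⟩ := exists_feasible_of_mul_neg hab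
    exact ⟨σ, h1, fun κ hκ s' _ => h2 κ hκ s'⟩
  · rcases mul_eq_zero.1 hab with rfl | rfl
    · exact exists_feasible_of_eq_zero (by simpa using h0)
    · obtain ⟨σ, h1, h2⟩ := exists_feasible_of_eq_zero (b := a) (by simpa using h0)
      refine ⟨-σ, by simpa using h1, fun κ hκ s' hs' => Feasible.swap ?_⟩
      simpa using h2 κ hκ (-s') (by simpa using hs')

/-- A direction with positive product only asks for heights of opposite signs. One with negative
product fixes the sign of its first height and leaves the other free. A degenerate one fixes that
sign and wants the other height twice as large in absolute value; `y` of size 1 and `y'` of size 2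
meet all demands, as only the first cone may be degenerate. -/
theorem exists_heights_aux {a₁ a₂ b₁ b₂ D D' : ℝ} (ha : a₁ ≠ 0 ∨ a₂ ≠ 0) (hb : b₁ * b₂ ≠ 0)
    (hD : D ≠ 0) (hD' : D' ≠ 0) :
    ∃ y y' : ℝ, Feasible a₁ a₂ (y * D) (y' * D) ∧ Feasible b₁ b₂ (y' * D') (y * D') := by
  -- For `|σ| = 1`, the number `σ * |E| / E` is the sign that turns `E` into `σ * |E|`.
  have sgn : ∀ E σ : ℝ, E ≠ 0 → σ * |E| / E * E = σ * |E| := fun E σ hE => by field_simp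
  have abs_one : ∀ E σ : ℝ, E ≠ 0 → |σ| = 1 → |σ * |E| / E| = 1 := fun E σ hE hσ => by
    rw [abs_div, abs_mul, hσ, abs_abs, one_mul, div_self (abs_ne_zero.2 hE)]
  have key : ∀ y y' E : ℝ, E ≠ 0 → y * y' < 0 → (y * E) * (y' * E) < 0 := by
    intro y y' E hE h
    have : 0 < E ^ 2 := by positivity
    nlinarith
  rcases lt_or_gt_of_ne hb with hb | hb
  · obtain ⟨σ', hσ', hC⟩ := exists_feasible_of_mul_neg hb
    have hy' := abs_one D' σ' hD' hσ'
    have hs' := sgn D' σ' hD'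
    set z := σ' * |D'| / D'
    have hz : 0 < z ^ 2 := by
      have : z ≠ 0 := by
        rintro h
        simp [h] at hy'
      positivity
    have hCz : ∀ y, Feasible b₁ b₂ (2 * z * D') (y * D') := fun y => by
      have := hC (2 * |D'|) (by positivity) (y * D')
      rwa [show σ' * (2 * |D'|) = 2 * z * D' by linarith] at this
    rcases le_or_gt (a₁ * a₂) 0 with h | h
    · obtain ⟨σ, hσ, hA⟩ := exists_feasible_of_mul_nonpos h ha
      refine ⟨σ * |D| / D, 2 * z, ?_, hCz _⟩
      rw [sgn D σ hD]
      apply hA _ (abs_pos.2 hD)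
      rw [abs_mul, abs_mul, hy']
      simp
    · refine ⟨-z, 2 * z, feasible_of_mul_pos h (key _ _ _ hD ?_), hCz _⟩
      nlinarith
  · rcases le_or_gt (a₁ * a₂) 0 with h | h
    · obtain ⟨σ, hσ, hA⟩ := exists_feasible_of_mul_nonpos h ha
      have hy := abs_one D σ hD hσ
      have hs := sgn D σ hD
      set z := σ * |D| / D
      have hz : 0 < z ^ 2 := by
        have : z ≠ 0 := by
          rintro h
          simp [h] at hy
        positivity
      refine ⟨z, -2 * z, ?_, feasible_of_mul_pos hb (key _ _ _ hD' ?_)⟩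
      · rw [hs]
        apply hA _ (abs_pos.2 hD)
        rw [abs_mul, abs_mul, hy]
        simp
      · nlinarith
    · exact ⟨1, -1, feasible_of_mul_pos h (key _ _ _ hD (by norm_num)),
        feasible_of_mul_pos hb (key _ _ _ hD' (by norm_num))⟩

theorem exists_heights {a₁ a₂ b₁ b₂ D D' : ℝ} (ha : a₁ ≠ 0 ∨ a₂ ≠ 0) (hb : b₁ ≠ 0 ∨ b₂ ≠ 0)
    (hab : ¬ (a₁ * a₂ = 0 ∧ b₁ * b₂ = 0)) (hD : D ≠ 0) (hD' : D' ≠ 0) :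
    ∃ y y' : ℝ, Feasible a₁ a₂ (y * D) (y' * D) ∧ Feasible b₁ b₂ (y' * D') (y * D') := by
  by_cases h : b₁ * b₂ = 0
  · obtain ⟨y, y', h1, h2⟩ := exists_heights_aux hb (fun h' => hab ⟨h', h⟩) hD' hD
    exact ⟨y', y, h2, h1⟩
  · exact exists_heights_aux ha h hD hD'

theorem exists_translate_of_height {a₁ a₂ c₁ c₂ y p q : ℝ} (ha : a₁ ≠ 0 ∨ a₂ ≠ 0)
    (h : a₁ * q - a₂ * p = y * (a₁ * c₂ - a₂ * c₁)) :
    ∃ t : ℝ, y * c₁ + t * a₁ = p ∧ y * c₂ + t * a₂ = q := by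
  rcases ha with ha | ha
  · refine ⟨(p - y * c₁) / a₁, by field_simp; ring, ?_⟩
    field_simp
    linarith
  · refine ⟨(q - y * c₂) / a₂, ?_, by field_simp; ring⟩
    field_simp
    linarith

/-- The convex cone cut out by two linear inequalities. -/
def cone (f₁ f₂ : Plane →ₗ[ℝ] ℝ) : Set Plane := {x | 0 ≤ f₁ x ∧ 0 ≤ f₂ x}

theorem scaleInvariant_cone (f₁ f₂ : Plane →ₗ[ℝ] ℝ) : ScaleInvariant (cone f₁ f₂) := by
  intro δ x hδ
  simp [cone, hδ]

theorem isClosed_cone (f₁ f₂ : Plane →ₗ[ℝ] ℝ) : IsClosed (cone f₁ f₂) :=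
  (isClosed_le continuous_const f₁.continuous_of_finiteDimensional).inter
    (isClosed_le continuous_const f₂.continuous_of_finiteDimensional)

theorem mem_interior_cone {f₁ f₂ : Plane →ₗ[ℝ] ℝ} {x : Plane} (h₁ : 0 < f₁ x) (h₂ : 0 < f₂ x) :
    x ∈ interior (cone f₁ f₂) := by
  have ho : IsOpen {x | 0 < f₁ x ∧ 0 < f₂ x} :=
    (isOpen_lt continuous_const f₁.continuous_of_finiteDimensional).inter
      (isOpen_lt continuous_const f₂.continuous_of_finiteDimensional)
  have hsub : {x | 0 < f₁ x ∧ 0 < f₂ x} ⊆ cone f₁ f₂ := fun x hx => ⟨hx.1.le, hx.2.le⟩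
  exact interior_maximal hsub ho ⟨h₁, h₂⟩

theorem Separated.cone {f₁ f₂ : Plane →ₗ[ℝ] ℝ} {u v : Plane}
    (h : Separated (f₁ u) (f₂ u) (f₁ v) (f₂ v)) :
    u ∈ interior (cone f₁ f₂) ∧ v ∉ cone f₁ f₂ ∧ u - v ∉ cone f₁ f₂ ∧ v - u ∉ cone f₁ f₂ ∧
      u ≠ 0 := by
  have hu : u ≠ 0 := by
    rintro rfl
    rcases h with h | h <;> simp at h
  rcases h with ⟨h1, h2, h3, h4⟩ | ⟨h1, h2, h3, h4⟩
  · refine ⟨mem_interior_cone h2 h3, fun h => ?_, fun h => ?_, fun h => ?_, hu⟩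
    · linarith [h.1]
    · have := h.2
      simp only [map_sub] at this
      linarith
    · have := h.1
      simp only [map_sub] at this
      linarith
  · refine ⟨mem_interior_cone h3 h2, fun h => ?_, fun h => ?_, fun h => ?_, hu⟩
    · linarith [h.2]
    · have := h.1
      simp only [map_sub] at this
      linarith
    · have := h.2
      simp only [map_sub] at this
      linarith

theorem Feasible.exists_separated {f₁ f₂ : Plane →ₗ[ℝ] ℝ} {d e : Plane}
    (ha : f₁ d ≠ 0 ∨ f₂ d ≠ 0) {y y' : ℝ}
    (h : Feasible (f₁ d) (f₂ d) (y * (f₁ d * f₂ e - f₂ d * f₁ e))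
      (y' * (f₁ d * f₂ e - f₂ d * f₁ e))) :
    ∃ t t' : ℝ, Separated (f₁ (y • e + t • d)) (f₂ (y • e + t • d))
      (f₁ (y' • e + t' • d)) (f₂ (y' • e + t' • d)) := by
  obtain ⟨p, q, p', q', h1, h2, h3⟩ := h
  obtain ⟨t, ht1, ht2⟩ := exists_translate_of_height ha h1
  obtain ⟨t', ht1', ht2'⟩ := exists_translate_of_height ha h2
  refine ⟨t, t', ?_⟩
  simpa [ht1, ht2, ht1', ht2'] using h3

/-- The ratio component `t' - t` shifts the two corners relative to each other along `C - A`; only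
the height `y` is shared. -/
theorem exists_cornerMap_eq (A C e : Plane) (y t t' : ℝ) :
    ∃ θ : ℝ × Plane, cornerMap A θ = y • e + t • (C - A) ∧
      cornerMap C θ = y • e + t' • (C - A) := by
  refine ⟨(t' - t, y • e + t • (C - A) - (t' - t) • A), ?_, ?_⟩
  · rw [cornerMap_apply]
    module
  · rw [cornerMap_apply]
    module

theorem det_ne_zero_of_independent {f₁ f₂ : Plane →ₗ[ℝ] ℝ}
    (hf : ∀ x, f₁ x = 0 → f₂ x = 0 → x = 0) {d e : Plane} (hde : LinearIndependent ℝ ![d, e]) :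
    f₁ d * f₂ e - f₂ d * f₁ e ≠ 0 := by
  intro h
  rw [LinearIndependent.pair_iff] at hde
  have h1 := hde (f₁ e) (-f₁ d) (hf _ (by simp; ring) (by simp; linarith))
  have h2 := hde (f₂ e) (-f₂ d) (hf _ (by simp; linarith) (by simp; ring))
  have hd : d = 0 := hf d (by linarith [h1.2]) (by linarith [h2.2])
  have := hde 1 0 (by simp [hd])
  simp at this

theorem exists_independent {d : Plane} (hd : d ≠ 0) : ∃ e : Plane, LinearIndependent ℝ ![d, e] := by
  refine ⟨!₂[-d 1, d 0], ?_⟩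
  rw [LinearIndependent.pair_iff]
  intro s t h
  have h0 := congrArg (fun x : Plane => x 0) h
  have h1 := congrArg (fun x : Plane => x 1) h
  simp at h0 h1
  have hpos : 0 < d 0 ^ 2 + d 1 ^ 2 := by
    by_contra hn
    apply hd
    have e0 : d 0 = 0 := by nlinarith [sq_nonneg (d 0), sq_nonneg (d 1)]
    have e1 : d 1 = 0 := by nlinarith [sq_nonneg (d 0), sq_nonneg (d 1)]
    ext i
    fin_cases i <;> simp [e0, e1]
  constructor
  · apply (mul_eq_zero.1 (show s * (d 0 ^ 2 + d 1 ^ 2) = 0 by linear_combination d 0 * h0 + d 1 * h1)).resolve_right hpos.ne'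
  · apply (mul_eq_zero.1 (show t * (d 0 ^ 2 + d 1 ^ 2) = 0 by linear_combination d 0 * h1 - d 1 * h0)).resolve_right hpos.ne'

/-- A set that looks like a convex cone near two points, not both of which have a side of the cone
on the line joining them, gives rise to indecomposable coverings. -/
theorem exists_indecomposable_of_cones {S : Set Plane} (hS : IsCompact S) (hS' : S.Nontrivial)
    {A C : Plane} (hAC : A ≠ C) {f₁ f₂ g₁ g₂ : Plane →ₗ[ℝ] ℝ}
    (hf : ∀ x, f₁ x = 0 → f₂ x = 0 → x = 0) (hg : ∀ x, g₁ x = 0 → g₂ x = 0 → x = 0)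
    (hA : ∀ᶠ x in 𝓝 A, x ∈ S ↔ x - A ∈ cone f₁ f₂)
    (hC : ∀ᶠ x in 𝓝 C, x ∈ S ↔ x - C ∈ cone g₁ g₂)
    (hd : ¬ ((f₁ (C - A) = 0 ∨ f₂ (C - A) = 0) ∧ (g₁ (C - A) = 0 ∨ g₂ (C - A) = 0))) (m : ℕ) :
    ∃ 𝒞 : Set (Set Plane),
      (∀ D ∈ 𝒞, IsHomotheticCopy S D) ∧ IsFoldCovering m 𝒞 ∧ ¬ IsDecomposable 𝒞 := by
  have hd0 : C - A ≠ 0 := sub_ne_zero.2 hAC.symm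
  obtain ⟨e, he⟩ := exists_independent hd0
  have hf' : f₁ (C - A) ≠ 0 ∨ f₂ (C - A) ≠ 0 := by
    by_contra! h
    exact hd0 (hf _ h.1 h.2)
  have hg' : g₁ (C - A) ≠ 0 ∨ g₂ (C - A) ≠ 0 := by
    by_contra! h
    exact hd0 (hg _ h.1 h.2)
  obtain ⟨y, y', h1, h2⟩ := exists_heights hf' hg' (by simpa only [mul_eq_zero] using hd)
    (det_ne_zero_of_independent hf he) (det_ne_zero_of_independent hg he)
  obtain ⟨t, t', h1⟩ := h1.exists_separated hf'
  obtain ⟨r', r, h2⟩ := h2.exists_separated hg'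
  obtain ⟨p, hp1, hp2⟩ := exists_cornerMap_eq A C e y t r
  obtain ⟨q, hq1, hq2⟩ := exists_cornerMap_eq A C e y' t' r'
  rw [← hp1, ← hq1] at h1
  rw [← hp2, ← hq2] at h2
  obtain ⟨i1, i2, i3, i4, i5⟩ := h1.cone
  obtain ⟨j1, j2, j3, j4, j5⟩ := h2.cone
  obtain ⟨V, X, Y, h⟩ := exists_isForcing (isClosed_cone f₁ f₂) (isClosed_cone g₁ g₂)
    (scaleInvariant_cone f₁ f₂) (scaleInvariant_cone g₁ g₂) i1 i2 i3 i4 j1 j2 j4 j3 i5 j5 m m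
  exact exists_indecomposable_of_isForcing hS hS' (scaleInvariant_cone f₁ f₂)
    (scaleInvariant_cone g₁ g₂) hA hC h

end Directions

/-! ### Local shape of a regular closed set at a corner -/

section Corner

theorem IsPreconnected.subset_interior_of_disjoint_frontier {X : Type*} [TopologicalSpace X]
    {S K : Set X} (hK : IsPreconnected K) (hd : Disjoint K (frontier S))
    (hne : (K ∩ S).Nonempty) : K ⊆ interior S := by
  have hsub : K ⊆ interior S ∪ (closure S)ᶜ := by
    intro x hx
    by_contra h
    simp only [mem_union, mem_compl_iff, not_or, not_not] at h
    exact disjoint_left.1 hd hx ⟨h.2, h.1⟩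
  refine hK.subset_left_of_subset_union isOpen_interior isClosed_closure.isOpen_compl ?_ hsub ?_
  · rw [disjoint_left]
    exact fun x hx h => h (subset_closure (interior_subset hx))
  · obtain ⟨x, hx, hxS⟩ := hne
    exact ⟨x, hx, (hsub hx).resolve_right fun h => h (subset_closure hxS)⟩

theorem exists_pos_forall_mem_of_isOpen {U : Set (ℝ × ℝ)} (hU : IsOpen U) {z : ℝ × ℝ} (hz : z ∈ U)
    (c d : ℝ) {ρ : ℝ} (hρ : 0 < ρ) : ∃ s, 0 < s ∧ s < ρ ∧ (z.1 + s * c, z.2 + s * d) ∈ U := by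
  have h := eventually_add_smul_mem hU hz (c, d)
  have h2 : ∀ᶠ s : ℝ in 𝓝[>] 0, s ∈ Ioo 0 ρ := Ioo_mem_nhdsGT hρ
  obtain ⟨s, hs, hs'⟩ := (h.and h2).exists
  refine ⟨s, hs'.1, hs'.2, ?_⟩
  exact hs

/-- A regular closed set whose frontier near its frontier point `0` is contained in the two
nonnegative half-axes coincides near `0` with the nonnegative quadrant or contains the complement of
this quadrant. -/
theorem quadrant_dichotomy {S : Set (ℝ × ℝ)} (hS : closure (interior S) = S) {ρ : ℝ} (hρ : 0 < ρ)
    (h0 : (0, 0) ∈ frontier S)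
    (hfr : ∀ a b : ℝ, |a| < ρ → |b| < ρ → (a, b) ∈ frontier S → 0 ≤ a ∧ 0 ≤ b ∧ a * b = 0) :
    (∀ a b : ℝ, |a| < ρ → |b| < ρ → ((a, b) ∈ S ↔ 0 ≤ a ∧ 0 ≤ b)) ∨
    (∀ a b : ℝ, |a| < ρ → |b| < ρ → a < 0 ∨ b < 0 → (a, b) ∈ S) := by
  have hcl : IsClosed S := hS ▸ isClosed_closure
  set K : Set (ℝ × ℝ) := Ioo 0 ρ ×ˢ Ioo 0 ρ with hK
  set N : Set (ℝ × ℝ) := (Ioo (-ρ) 0 ×ˢ Ioo (-ρ) ρ) ∪ (Ioo (-ρ) ρ ×ˢ Ioo (-ρ) 0) with hN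
  have memN : ∀ a b : ℝ, |a| < ρ → |b| < ρ → a < 0 ∨ b < 0 → (a, b) ∈ N := by
    intro a b ha hb h
    rw [abs_lt] at ha hb
    rcases h with h | h
    · exact Or.inl ⟨⟨ha.1, h⟩, hb⟩
    · exact Or.inr ⟨ha, ⟨hb.1, h⟩⟩
  have Nmem : ∀ a b : ℝ, (a, b) ∈ N → |a| < ρ ∧ |b| < ρ ∧ (a < 0 ∨ b < 0) := by
    rintro a b (⟨⟨h1, h2⟩, h3⟩ | ⟨h3, ⟨h1, h2⟩⟩) <;> simp only at h1 h2 h3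
    · exact ⟨abs_lt.2 ⟨h1, h2.trans hρ⟩, abs_lt.2 h3, Or.inl h2⟩
    · exact ⟨abs_lt.2 h3, abs_lt.2 ⟨h1, h2.trans hρ⟩, Or.inr h2⟩
  have cK : IsPreconnected K := isPreconnected_Ioo.prod isPreconnected_Ioo
  have cN : IsPreconnected N := by
    apply IsPreconnected.union (-ρ / 2, -ρ / 2)
    · constructor <;> constructor <;> simp only <;> linarith
    · constructor <;> constructor <;> simp only <;> linarith
    · exact isPreconnected_Ioo.prod isPreconnected_Ioo
    · exact isPreconnected_Ioo.prod isPreconnected_Ioo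
  have dK : Disjoint K (frontier S) := by
    rw [disjoint_left]
    rintro ⟨a, b⟩ ⟨⟨h1, h2⟩, ⟨h3, h4⟩⟩ h
    simp only at h1 h2 h3 h4
    have := (hfr a b (abs_lt.2 ⟨by linarith, h2⟩) (abs_lt.2 ⟨by linarith, h4⟩) h).2.2
    exact (mul_pos h1 h3).ne' this
  have dN : Disjoint N (frontier S) := by
    rw [disjoint_left]
    rintro ⟨a, b⟩ hab h
    obtain ⟨h1, h2, h3⟩ := Nmem a b hab
    obtain ⟨h4, h5, -⟩ := hfr a b h1 h2 h
    rcases h3 with h3 | h3 <;> linarith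
  -- In the box, the open quadrant `K` and the exterior `N` of the closed quadrant are connected and
  -- miss the frontier, so each lies in `S` or avoids it.
  by_cases hNS : (N ∩ S).Nonempty
  · right
    intro a b ha hb h
    exact interior_subset (cN.subset_interior_of_disjoint_frontier dN hNS (memN a b ha hb h))
  left
  have hNS' : ∀ z ∈ N, z ∉ S := fun z h h' => hNS ⟨z, h, h'⟩
  have boxO : IsOpen (Ioo (-ρ) ρ ×ˢ Ioo (-ρ) ρ) := isOpen_Ioo.prod isOpen_Ioo
  have hKS : (K ∩ S).Nonempty := by
    have hc : ((0 : ℝ), (0 : ℝ)) ∈ closure (interior S) := by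
      rw [hS]
      exact hcl.frontier_subset h0
    obtain ⟨⟨a, b⟩, ⟨ha, hb⟩, hab⟩ := mem_closure_iff.1 hc _ boxO
      ⟨⟨by linarith, by linarith⟩, ⟨by linarith, by linarith⟩⟩
    simp only at ha hb
    -- An interior point pushed diagonally inwards still avoids `N`, so its original coordinates
    -- were strictly positive.
    obtain ⟨s, hs, hsρ, ⟨h1, h2⟩, h3⟩ := exists_pos_forall_mem_of_isOpen
      (z := (a, b)) (boxO.inter isOpen_interior) ⟨⟨ha, hb⟩, hab⟩ (-1) (-1) hρ
    simp only at h1 h2 h3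
    have hn := fun h => hNS' _ (memN _ _ (abs_lt.2 h1) (abs_lt.2 h2) h) (interior_subset h3)
    simp only [imp_false, not_or, not_lt] at hn
    exact ⟨(a, b), ⟨⟨by linarith [hn.1], ha.2⟩, ⟨by linarith [hn.2], hb.2⟩⟩, interior_subset hab⟩
  have hKi := (cK.subset_interior_of_disjoint_frontier dK hKS).trans interior_subset
  intro a b ha hb
  constructor
  · intro h
    by_contra hn
    apply hNS' _ (memN a b ha hb _) h
    by_contra! hn'
    exact hn hn'
  · rintro ⟨h1, h2⟩
    rw [← hcl.closure_eq, mem_closure_iff]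
    intro U hU hz
    rw [abs_lt] at ha hb
    obtain ⟨s, hs, hsρ, ⟨⟨h5, h6⟩, h3⟩⟩ := exists_pos_forall_mem_of_isOpen
      (z := (a, b)) (boxO.inter hU) ⟨⟨ha, hb⟩, hz⟩ 1 1 hρ
    simp only at h5 h6 h3
    exact ⟨_, h3, hKi ⟨⟨by simp only; linarith, h5.2⟩, ⟨by simp only; linarith, h6.2⟩⟩⟩

/-- Affine coordinates of the plane with origin `A`. -/
noncomputable def coordHomeomorph (A : Plane) (b : Module.Basis (Fin 2) ℝ Plane) :
    Plane ≃ₜ ℝ × ℝ where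
  toFun x := (b.coord 0 (x - A), b.coord 1 (x - A))
  invFun z := A + (z.1 • b 0 + z.2 • b 1)
  left_inv x := by
    have := b.sum_repr (x - A)
    rw [Fin.sum_univ_two] at this
    change A + (b.repr (x - A) 0 • b 0 + b.repr (x - A) 1 • b 1) = x
    rw [this]
    abel
  right_inv z := by
    simp
  continuous_toFun := by
    have h0 := (b.coord 0).continuous_of_finiteDimensional
    have h1 := (b.coord 1).continuous_of_finiteDimensional
    fun_prop
  continuous_invFun := by fun_prop

theorem coord_injective (b : Module.Basis (Fin 2) ℝ Plane) (x : Plane) (h0 : b.coord 0 x = 0)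
    (h1 : b.coord 1 x = 0) : x = 0 := by
  apply b.ext_elem
  intro i
  fin_cases i
  · simpa using h0
  · simpa using h1

/-- The local structure of a region at a vertex `A` on the boundary of its convex hull. -/
theorem eventually_mem_iff_mem_cone {S : Set Plane} (hS : closure (interior S) = S) {A : Plane}
    (hA : A ∈ frontier S) (hA' : A ∉ interior (convexHull ℝ S)) (b : Module.Basis (Fin 2) ℝ Plane)
    (hfr : ∀ᶠ x in 𝓝 A, x ∈ frontier S → 0 ≤ b.coord 0 (x - A) ∧ 0 ≤ b.coord 1 (x - A) ∧
      b.coord 0 (x - A) * b.coord 1 (x - A) = 0) :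
    ∀ᶠ x in 𝓝 A, x ∈ S ↔ x - A ∈ cone (b.coord 0) (b.coord 1) := by
  set φ := coordHomeomorph A b with hφ
  have hφA : φ A = (0, 0) := by simp [hφ, coordHomeomorph]
  have hφA' : φ.symm (0, 0) = A := by rw [← hφA, φ.symm_apply_apply]
  have boxnhds : ∀ ρ : ℝ, 0 < ρ → ∀ᶠ x in 𝓝 A, |(φ x).1| < ρ ∧ |(φ x).2| < ρ := by
    intro ρ hρ
    have h1 : IsOpen {x : Plane | |(φ x).1| < ρ ∧ |(φ x).2| < ρ} := by
      have h2 := φ.continuous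
      have c1 : Continuous fun x => |(φ x).1| := by fun_prop
      have c2 : Continuous fun x => |(φ x).2| := by fun_prop
      exact (isOpen_lt c1 continuous_const).inter (isOpen_lt c2 continuous_const)
    exact h1.mem_nhds (by simp [hφA, hρ])
  set S' : Set (ℝ × ℝ) := φ.symm ⁻¹' S with hS'
  obtain ⟨ρ, hρ, hbox⟩ : ∃ ρ > 0, ∀ a b : ℝ, |a| < ρ → |b| < ρ →
      (a, b) ∈ frontier S' → 0 ≤ a ∧ 0 ≤ b ∧ a * b = 0 := by
    have h1 := φ.symm.continuous.tendsto (0, 0)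
    rw [hφA'] at h1
    obtain ⟨ρ, hρ, h⟩ := Metric.eventually_nhds_iff.1 (h1.eventually hfr)
    refine ⟨ρ, hρ, fun a b' ha hb hab => ?_⟩
    have h2 : dist (a, b') ((0 : ℝ), (0 : ℝ)) < ρ := by
      simp [Prod.dist_eq, ha, hb]
    rw [hS', ← φ.symm.preimage_frontier] at hab
    have h3 := h h2 hab
    have h4 : φ (φ.symm (a, b')) = (a, b') := φ.apply_symm_apply _
    have e0 : b.coord 0 (φ.symm (a, b') - A) = a := congrArg Prod.fst h4
    have e1 : b.coord 1 (φ.symm (a, b') - A) = b' := congrArg Prod.snd h4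
    rwa [e0, e1] at h3
  have hreg : closure (interior S') = S' := by
    rw [hS', ← φ.symm.preimage_interior, ← φ.symm.preimage_closure, hS]
  have h0 : ((0 : ℝ), (0 : ℝ)) ∈ frontier S' := by
    rw [hS', ← φ.symm.preimage_frontier]
    simpa [hφA'] using hA
  rcases quadrant_dichotomy hreg hρ h0 hbox with h | h
  · filter_upwards [boxnhds ρ hρ] with x hx
    have := h _ _ hx.1 hx.2
    change x ∈ S ↔ 0 ≤ (φ x).1 ∧ 0 ≤ (φ x).2
    simpa [hS'] using this
  -- If `S` contained the exterior of the quadrant, each `x` near `A` would be the midpoint of `x ±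
  -- T • (b 0 - b 1)`, both in `S`, and `A` would be interior to the hull.
  · refine absurd ?_ hA'
    rw [mem_interior_iff_mem_nhds]
    filter_upwards [boxnhds (ρ / 4) (by linarith)] with x hx
    have hx1 := abs_lt.1 hx.1
    have hx2 := abs_lt.1 hx.2
    set T := ρ / 2 with hT
    have m1 : φ.symm ((φ x).1 + T, (φ x).2 - T) ∈ S := h _ _
      (abs_lt.2 ⟨by linarith, by linarith⟩) (abs_lt.2 ⟨by linarith, by linarith⟩)
      (Or.inr (by linarith))
    have m2 : φ.symm ((φ x).1 - T, (φ x).2 + T) ∈ S := h _ _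
      (abs_lt.2 ⟨by linarith, by linarith⟩) (abs_lt.2 ⟨by linarith, by linarith⟩)
      (Or.inl (by linarith))
    have hmid := (convex_convexHull ℝ S) (subset_convexHull ℝ S m1) (subset_convexHull ℝ S m2)
      (show (0 : ℝ) ≤ 1 / 2 by norm_num) (show (0 : ℝ) ≤ 1 / 2 by norm_num) (by norm_num)
    convert hmid using 1
    have hx' : x = A + ((φ x).1 • b 0 + (φ x).2 • b 1) := (φ.symm_apply_apply x).symm
    nth_rewrite 1 [hx']
    change _ = (1 / 2 : ℝ) • (A + (((φ x).1 + T) • b 0 + ((φ x).2 - T) • b 1)) +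
      (1 / 2 : ℝ) • (A + (((φ x).1 - T) • b 0 + ((φ x).2 + T) • b 1))
    module

end Corner

/-! ### Cyclic indices -/

section FinArithmetic

variable {n : ℕ} [NeZero n]

open scoped Fin.CommRing in
theorem Fin.two_eq_one_add_one : (2 : Fin n) = 1 + 1 := one_add_one_eq_two.symm

open scoped Fin.CommRing in
theorem Fin.three_eq_one_add_one_add_one : (3 : Fin n) = 1 + 1 + 1 := by norm_num

theorem Fin.one_ne_zero_of_three_le (h : 3 ≤ n) : (1 : Fin n) ≠ 0 := by
  obtain ⟨k, rfl⟩ := Nat.exists_eq_add_of_le' h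
  simp

theorem Fin.one_add_one_ne_zero_of_three_le (h : 3 ≤ n) : (1 + 1 : Fin n) ≠ 0 := by
  rw [← Fin.two_eq_one_add_one]
  obtain ⟨k, rfl⟩ := Nat.exists_eq_add_of_le' h
  simp [Fin.ext_iff, Nat.mod_eq_of_lt]

theorem Fin.one_add_one_add_one_ne_zero_of_four_le (h : 4 ≤ n) : (1 + 1 + 1 : Fin n) ≠ 0 := by
  rw [← Fin.three_eq_one_add_one_add_one]
  obtain ⟨k, rfl⟩ := Nat.exists_eq_add_of_le' h
  simp [Fin.ext_iff, Nat.mod_eq_of_lt]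

theorem Fin.eq_or_eq_add_one_or_eq_sub_one (i k : Fin 3) : k = i ∨ k = i + 1 ∨ k = i - 1 := by
  decide +revert

end FinArithmetic

/-! ### Suitable pairs of corners in polygons -/

section PolygonGeometry

variable {n : ℕ} [NeZero n] {P : Polygon Plane n} {S : Set Plane}

theorem edgeSet_eq_segment (P : Polygon Plane n) (i : Fin n) :
    P.edgeSet ℝ i = segment ℝ (P i) (P (i + 1)) := by
  rw [Polygon.edgeSet, affineSegment_eq_segment, finRotate_apply]

theorem not_collinear_neighbours (h : P.HasNondegenerateVertices ℝ) (i : Fin n) :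
    ¬ Collinear ℝ {P (i - 1), P i, P (i + 1)} := by
  have := h (i - 1)
  rw [affineIndependent_iff_not_collinear_set] at this
  rwa [Fin.two_eq_one_add_one, show i - 1 + 1 = i by abel,
    show i - 1 + (1 + 1) = i + 1 by abel] at this

theorem linearIndependent_edges (h : P.HasNondegenerateVertices ℝ) (i : Fin n) :
    LinearIndependent ℝ ![P (i + 1) - P i, P (i - 1) - P i] := by
  have hc := not_collinear_neighbours h i
  have hne : P (i + 1) - P i ≠ 0 := by
    intro h0
    rw [sub_eq_zero] at h0
    apply hc
    rw [h0]
    simpa using collinear_pair ℝ (P (i - 1)) (P i)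
  rw [LinearIndependent.pair_iff' hne]
  intro a ha
  apply hc
  rw [collinear_iff_of_mem (p₀ := P i) (by simp)]
  refine ⟨P (i + 1) - P i, ?_⟩
  simp only [mem_insert_iff, mem_singleton_iff, forall_eq_or_imp, forall_eq, vadd_eq_add]
  refine ⟨⟨a, by rw [ha]; abel⟩, ⟨0, by simp⟩, ⟨1, by simp⟩⟩

/-- The basis formed by the two sides issuing from a vertex. -/
noncomputable def cornerBasis (h : P.HasNondegenerateVertices ℝ) (i : Fin n) :
    Module.Basis (Fin 2) ℝ Plane :=
  basisOfLinearIndependentOfCardEqFinrank (linearIndependent_edges h i) (by simp)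

theorem cornerBasis_zero (h : P.HasNondegenerateVertices ℝ) (i : Fin n) :
    cornerBasis h i 0 = P (i + 1) - P i := by
  simp [cornerBasis]

theorem cornerBasis_one (h : P.HasNondegenerateVertices ℝ) (i : Fin n) :
    cornerBasis h i 1 = P (i - 1) - P i := by
  simp [cornerBasis]

theorem vertex_notMem_edgeSet (h : IsSimplePolygon P) {i j : Fin n} (hj : j ≠ i)
    (hj' : j ≠ i - 1) : P i ∉ P.edgeSet ℝ j := by
  intro hi
  have hmem : P i ∈ P.edgeSet ℝ i := by
    rw [edgeSet_eq_segment]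
    exact left_mem_segment ℝ _ _
  rcases (h.edge_inter i j hj.symm ⟨hmem, hi⟩).2 with h1 | h1
  · exact hj (h.injective h1).symm
  · have : i = j + 1 := h.injective h1
    exact hj' (by rw [this]; abel)

theorem eventually_boundary_subset_axes (h : IsSimplePolygon P) (i : Fin n) :
    ∀ᶠ x in 𝓝 (P i), x ∈ P.boundary ℝ →
      0 ≤ (cornerBasis h.nondegenerate i).coord 0 (x - P i) ∧
      0 ≤ (cornerBasis h.nondegenerate i).coord 1 (x - P i) ∧
      (cornerBasis h.nondegenerate i).coord 0 (x - P i) *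
        (cornerBasis h.nondegenerate i).coord 1 (x - P i) = 0 := by
  have hev : ∀ j : Fin n, j ≠ i → j ≠ i - 1 → ∀ᶠ x in 𝓝 (P i), x ∉ P.edgeSet ℝ j := by
    intro j h1 h2
    have hcl : IsClosed (P.edgeSet ℝ j) := by
      rw [edgeSet_eq_segment, ← convexHull_pair]
      exact ((toFinite _).isCompact_convexHull ℝ).isClosed
    exact hcl.isOpen_compl.mem_nhds (vertex_notMem_edgeSet h h1 h2)
  have hall : ∀ᶠ x in 𝓝 (P i), ∀ j, j ≠ i → j ≠ i - 1 → x ∉ P.edgeSet ℝ j := by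
    simp only [eventually_all]
    exact hev
  filter_upwards [hall] with x hx hb
  obtain ⟨j, hj⟩ := mem_iUnion.1 hb
  set b := cornerBasis h.nondegenerate i
  by_cases h1 : j = i
  · subst h1
    rw [edgeSet_eq_segment, segment_eq_image'] at hj
    obtain ⟨t, ht, rfl⟩ := hj
    have e : P j + t • (P (j + 1) - P j) - P j = t • b 0 := by
      rw [cornerBasis_zero]
      abel
    rw [e]
    simp [ht.1]
  by_cases h2 : j = i - 1
  · subst h2
    rw [edgeSet_eq_segment, segment_symm, segment_eq_image', show i - 1 + 1 = i by abel] at hj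
    obtain ⟨t, ht, rfl⟩ := hj
    have e : P i + t • (P (i - 1) - P i) - P i = t • b 1 := by
      rw [cornerBasis_one]
      abel
    rw [e]
    simp [ht.1]
  exact absurd hj (hx j h1 h2)

theorem vertex_mem_frontier (hS : IsPolygonWithBoundary S P) (i : Fin n) : P i ∈ frontier S := by
  rw [hS.frontier_eq]
  refine mem_iUnion.2 ⟨i, ?_⟩
  rw [edgeSet_eq_segment]
  exact left_mem_segment ℝ _ _

theorem vertex_mem (hS : IsPolygonWithBoundary S P) (i : Fin n) : P i ∈ S :=
  hS.isCompact.isClosed.frontier_subset (vertex_mem_frontier hS i)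

theorem nontrivial_region (hS : IsPolygonWithBoundary S P) : S.Nontrivial := by
  refine ⟨P 0, vertex_mem hS 0, P 1, vertex_mem hS 1, fun h => ?_⟩
  exact Fin.one_ne_zero_of_three_le hS.simple.nondegenerate.three_le
    (hS.simple.injective h).symm

/-- The cone spanned by the two sides issuing from a vertex. -/
noncomputable def cornerCone (h : P.HasNondegenerateVertices ℝ) (i : Fin n) : Set Plane :=
  cone ((cornerBasis h i).coord 0) ((cornerBasis h i).coord 1)

theorem eventually_mem_iff_mem_cornerCone (hS : IsPolygonWithBoundary S P) {i : Fin n}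
    (hi : P i ∉ interior (convexHull ℝ S)) :
    ∀ᶠ x in 𝓝 (P i), x ∈ S ↔ x - P i ∈ cornerCone hS.simple.nondegenerate i := by
  refine eventually_mem_iff_mem_cone hS.closure_interior (vertex_mem_frontier hS i) hi _ ?_
  rw [hS.frontier_eq]
  exact eventually_boundary_subset_axes hS.simple i

/-- A vector along a side of the corner at the vertex `i` is a multiple of one of the two edge
vectors at this vertex. -/
theorem exists_eq_smul_edge (h : P.HasNondegenerateVertices ℝ) {i : Fin n} {d : Plane}
    (hd : (cornerBasis h i).coord 0 d = 0 ∨ (cornerBasis h i).coord 1 d = 0) :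
    ∃ e : Fin n, (e = i ∨ e = i - 1) ∧ ∃ c : ℝ, d = c • (P (e + 1) - P e) := by
  have hr := (cornerBasis h i).sum_repr d
  rw [Fin.sum_univ_two, cornerBasis_zero, cornerBasis_one] at hr
  simp only [Module.Basis.coord_apply] at hd
  rcases hd with hd | hd
  · refine ⟨i - 1, Or.inr rfl, -(cornerBasis h i).repr d 1, ?_⟩
    rw [hd, zero_smul, zero_add] at hr
    rw [show i - 1 + 1 = i by abel, ← hr]
    simp only [hr]
    rw [neg_smul, ← smul_neg, neg_sub, hr]
  · refine ⟨i, Or.inl rfl, (cornerBasis h i).repr d 0, ?_⟩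
    rw [hd, zero_smul, add_zero] at hr
    exact hr.symm

/-- The construction of indecomposable coverings from two corners of the convex hull. -/
theorem exists_indecomposable_of_corners (hS : IsPolygonWithBoundary S P) {i j : Fin n}
    (hij : i ≠ j) (hi : P i ∉ interior (convexHull ℝ S)) (hj : P j ∉ interior (convexHull ℝ S))
    (hd : ∀ e e' : Fin n, (e = i ∨ e = i - 1) → (e' = j ∨ e' = j - 1) →
      (∃ c : ℝ, P j - P i = c • (P (e + 1) - P e)) →
      (∃ c : ℝ, P j - P i = c • (P (e' + 1) - P e')) → False) (m : ℕ) :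
    ∃ 𝒞 : Set (Set Plane),
      (∀ D ∈ 𝒞, IsHomotheticCopy S D) ∧ IsFoldCovering m 𝒞 ∧ ¬ IsDecomposable 𝒞 := by
  refine exists_indecomposable_of_cones hS.isCompact (nontrivial_region hS)
    (fun h => hij (hS.simple.injective h)) (coord_injective _) (coord_injective _)
    (eventually_mem_iff_mem_cornerCone hS hi) (eventually_mem_iff_mem_cornerCone hS hj) ?_ m
  rintro ⟨h1, h2⟩
  obtain ⟨e, he, hc⟩ := exists_eq_smul_edge _ h1
  obtain ⟨e', he', hc'⟩ := exists_eq_smul_edge _ h2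
  exact hd e e' he he' hc hc'

theorem parallel_of_smul_eq {A B C D d : Plane} (hd : d ≠ 0) {c c' : ℝ} (h : d = c • (B - A))
    (h' : d = c' • (D - C)) : (affineSpan ℝ {A, B}).Parallel (affineSpan ℝ {C, D}) := by
  rw [AffineSubspace.affineSpan_pair_parallel_iff_vectorSpan_eq, vectorSpan_pair_rev,
    vectorSpan_pair_rev, vsub_eq_sub, vsub_eq_sub]
  have hc : c ≠ 0 := fun h0 => hd (by rw [h, h0, zero_smul])
  have hc' : c' ≠ 0 := fun h0 => hd (by rw [h', h0, zero_smul])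
  rw [← Submodule.span_singleton_smul_eq hc.isUnit, ← h,
    ← Submodule.span_singleton_smul_eq hc'.isUnit (D - C), ← h']

/-! ### Convex polygons -/

theorem vertex_notMem_interior_of_convex (hS : IsPolygonWithBoundary S P) (hc : Convex ℝ S)
    (i : Fin n) : P i ∉ interior (convexHull ℝ S) := by
  rw [hc.convexHull_eq]
  exact (vertex_mem_frontier hS i).2

/-- Convexity brings `x` along a segment to a point of `S` near the vertex, where the local
description applies; the cone is scale invariant. -/
theorem sub_mem_cornerCone (hS : IsPolygonWithBoundary S P) (hc : Convex ℝ S) (i : Fin n)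
    {x : Plane} (hx : x ∈ S) : x - P i ∈ cornerCone hS.simple.nondegenerate i := by
  have h := eventually_mem_iff_mem_cornerCone hS (vertex_notMem_interior_of_convex hS hc i)
  obtain ⟨U, hU, hUo, hiU⟩ := eventually_nhds_iff.1 h
  have h2 : ∀ᶠ δ : ℝ in 𝓝[>] 0, δ ∈ Ioo (0 : ℝ) 1 := Ioo_mem_nhdsGT one_pos
  obtain ⟨δ, h3, h4, h5⟩ := ((eventually_add_smul_mem hUo hiU (x - P i)).and h2).exists
  have h6 : P i + δ • (x - P i) ∈ S := hc.add_smul_sub_mem (vertex_mem hS i) hx ⟨h4.le, h5.le⟩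
  rw [hU _ h3, add_sub_cancel_left] at h6
  exact (scaleInvariant_cone _ _ _ _ h4).1 h6

/-- The corner cone is pointed, so it contains no two opposite nonzero vectors. -/
theorem not_wbtw_vertex (hS : IsPolygonWithBoundary S P) (hc : Convex ℝ S) {i : Fin n}
    {x z : Plane} (hx : x ∈ S) (hz : z ∈ S) (hxi : P i ≠ x) (hzi : P i ≠ z) :
    ¬ Wbtw ℝ x (P i) z := by
  rintro ⟨t, ht, he⟩
  have h1 := sub_mem_cornerCone hS hc i hx
  have h2 := sub_mem_cornerCone hS hc i hz
  rw [AffineMap.lineMap_apply, vsub_eq_sub, vadd_eq_add] at he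
  have e1 : x - P i = -t • (z - x) := by
    rw [← he]
    module
  have e2 : z - P i = (1 - t) • (z - x) := by
    rw [← he]
    module
  have t0 : 0 < t := by
    apply lt_of_le_of_ne ht.1
    rintro rfl
    exact hxi (by rw [← he]; simp)
  have t1 : t < 1 := by
    apply lt_of_le_of_ne ht.2
    rintro rfl
    exact hzi (by rw [← he]; simp)
  have key : ∀ k, 0 ≤ (cornerBasis hS.simple.nondegenerate i).coord k (x - P i) →
      0 ≤ (cornerBasis hS.simple.nondegenerate i).coord k (z - P i) →
      (cornerBasis hS.simple.nondegenerate i).coord k (z - x) = 0 := by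
    intro k h3 h4
    rw [e1, map_smul, smul_eq_mul] at h3
    rw [e2, map_smul, smul_eq_mul] at h4
    have h5 := nonneg_of_mul_nonneg_right h4 (by linarith)
    nlinarith
  have h0 := coord_injective _ _ (key 0 h1.1 h2.1) (key 1 h1.2 h2.2)
  apply hxi
  rw [← he, h0, smul_zero, zero_add]

theorem not_collinear_of_convex (hS : IsPolygonWithBoundary S P) (hc : Convex ℝ S)
    {i j k : Fin n} (hij : i ≠ j) (hjk : j ≠ k) (hik : i ≠ k) :
    ¬ Collinear ℝ {P i, P j, P k} := by
  have ne : ∀ {a b : Fin n}, a ≠ b → P a ≠ P b := fun h h' => h (hS.simple.injective h')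
  intro h
  rcases h.wbtw_or_wbtw_or_wbtw with h | h | h
  · exact not_wbtw_vertex hS hc (vertex_mem hS _) (vertex_mem hS _) (ne hij.symm) (ne hjk) h
  · exact not_wbtw_vertex hS hc (vertex_mem hS _) (vertex_mem hS _) (ne hjk.symm) (ne hik.symm) h
  · exact not_wbtw_vertex hS hc (vertex_mem hS _) (vertex_mem hS _) (ne hik) (ne hij) h

theorem exists_indecomposable_of_convex (hS : IsPolygonWithBoundary S P) (hc : Convex ℝ S)
    (hn : 4 ≤ n) (m : ℕ) :
    ∃ 𝒞 : Set (Set Plane),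
      (∀ D ∈ 𝒞, IsHomotheticCopy S D) ∧ IsFoldCovering m 𝒞 ∧ ¬ IsDecomposable 𝒞 := by
  have n1 := Fin.one_ne_zero_of_three_le (n := n) (by omega)
  have n2 := Fin.one_add_one_ne_zero_of_three_le (n := n) (by omega)
  have n3 := Fin.one_add_one_add_one_ne_zero_of_four_le hn
  have n12 : (1 : Fin n) ≠ 1 + 1 := fun h => n1 (by simpa using h)
  refine exists_indecomposable_of_corners hS (i := 0) (j := 1 + 1) n2.symm
    (vertex_notMem_interior_of_convex hS hc _) (vertex_notMem_interior_of_convex hS hc _) ?_ m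
  rintro e - (rfl | rfl) - ⟨c, h⟩ -
  -- A side at vertex 0 along the diagonal to `1 + 1` would make three distinct vertices collinear;
  -- for the side from `0 - 1` distinctness needs four sides.
  · apply not_collinear_of_convex hS hc n1.symm n12 n2.symm
    rw [collinear_iff_of_mem (p₀ := P 0) (by simp)]
    refine ⟨P (0 + 1) - P 0, ?_⟩
    simp only [mem_insert_iff, mem_singleton_iff, forall_eq_or_imp, forall_eq, vadd_eq_add]
    refine ⟨⟨0, by simp⟩, ⟨1, by simp⟩, ⟨c, by rw [← h]; simp⟩⟩
  · have m1 : (0 : Fin n) ≠ 0 - 1 := fun h => n1 (by simpa using h)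
    have m2 : (0 - 1 : Fin n) ≠ 1 + 1 := fun h => n3 (by rw [← h]; abel)
    apply not_collinear_of_convex hS hc m1 m2 n2.symm
    rw [collinear_iff_of_mem (p₀ := P 0) (by simp)]
    rw [show (0 - 1 + 1 : Fin n) = 0 by abel] at h
    refine ⟨P 0 - P (0 - 1), ?_⟩
    simp only [mem_insert_iff, mem_singleton_iff, forall_eq_or_imp, forall_eq, vadd_eq_add]
    refine ⟨⟨0, by simp⟩, ⟨-1, by simp⟩, ⟨c, by rw [← h]; simp⟩⟩

/-! ### Concave polygons -/

theorem convexHull_region_eq (hS : IsPolygonWithBoundary S P) :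
    convexHull ℝ S = convexHull ℝ (range P.vertices) := by
  apply Subset.antisymm
  · have hcl : IsClosed (convexHull ℝ (range P.vertices)) :=
      ((finite_range _).isCompact_convexHull ℝ).isClosed
    have hbd : frontier S ⊆ convexHull ℝ (range P.vertices) := by
      rw [hS.frontier_eq]
      refine iUnion_subset fun i => ?_
      rw [edgeSet_eq_segment]
      exact segment_subset_convexHull (mem_range_self _) (mem_range_self _)
    refine convexHull_min (fun x hx => ?_) (convex_convexHull ℝ _)
    by_contra hn
    -- A separating functional would attain its maximum over `S` at an interior point, from which a
    -- small move along `x - P.vertices 0` increases it.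
    obtain ⟨f, u, hf, hu⟩ := geometric_hahn_banach_closed_point (convex_convexHull ℝ _) hcl hn
    obtain ⟨z, hz, hmax⟩ := hS.isCompact.exists_isMaxOn ⟨x, hx⟩ (f := f)
      f.continuous.continuousOn
    have hxz : f x ≤ f z := hmax hx
    have hzi : z ∈ interior S := by
      by_contra hzi
      have := hf z (hbd ⟨subset_closure hz, hzi⟩)
      linarith
    have hP := hf _ (subset_convexHull ℝ _ (mem_range_self (0 : Fin n)))
    obtain ⟨δ, h1, h2⟩ := ((eventually_add_smul_mem isOpen_interior hzi
      (x - P.vertices 0)).and self_mem_nhdsWithin).exists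
    have h3 : f (z + δ • (x - P.vertices 0)) ≤ f z := hmax (interior_subset h1)
    rw [map_add, map_smul, map_sub, smul_eq_mul] at h3
    have h2' : (0 : ℝ) < δ := h2
    nlinarith
  · apply convexHull_mono
    rintro _ ⟨i, rfl⟩
    exact vertex_mem hS i

theorem closure_convexHull_extreme_vertices (hS : IsPolygonWithBoundary S P) :
    closure (convexHull ℝ ((convexHull ℝ S).extremePoints ℝ)) = convexHull ℝ S := by
  apply closure_convexHull_extremePoints _ (convex_convexHull ℝ S)
  rw [convexHull_region_eq hS]
  exact (finite_range _).isCompact_convexHull ℝ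

theorem exists_vertex_eq_of_mem_extremePoints (hS : IsPolygonWithBoundary S P) {x : Plane}
    (hx : x ∈ (convexHull ℝ S).extremePoints ℝ) : ∃ i, P i = x := by
  rw [convexHull_region_eq hS] at hx
  have h : x ∈ range P.vertices := extremePoints_convexHull_subset hx
  exact h

theorem region_subset_segment (hS : IsPolygonWithBoundary S P) {i j : Fin n}
    (h : ∀ k, P k ∈ (convexHull ℝ S).extremePoints ℝ → k = i ∨ k = j) :
    S ⊆ segment ℝ (P i) (P j) := by
  have hcl : IsClosed (segment ℝ (P i) (P j)) := by
    rw [← convexHull_pair]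
    exact ((toFinite _).isCompact_convexHull ℝ).isClosed
  refine (subset_convexHull ℝ S).trans ?_
  rw [← closure_convexHull_extreme_vertices hS]
  refine closure_minimal (convexHull_min ?_ (convex_segment _ _)) hcl
  intro x hx
  obtain ⟨k, rfl⟩ := exists_vertex_eq_of_mem_extremePoints hS hx
  rcases h k hx with rfl | rfl
  exacts [left_mem_segment ℝ _ _, right_mem_segment ℝ _ _]

theorem not_region_subset_segment (hS : IsPolygonWithBoundary S P) (i j : Fin n) :
    ¬ S ⊆ segment ℝ (P i) (P j) := by
  intro h
  apply not_collinear_neighbours hS.simple.nondegenerate 0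
  rw [collinear_iff_exists_forall_eq_smul_vadd]
  refine ⟨P i, P j - P i, ?_⟩
  have main : ∀ k, ∃ r : ℝ, P k = r • (P j - P i) +ᵥ P i := by
    intro k
    have hk := h (vertex_mem hS k)
    rw [segment_eq_image'] at hk
    obtain ⟨t, -, ht⟩ := hk
    exact ⟨t, by rw [← ht, vadd_eq_add, add_comm]⟩
  simp only [mem_insert_iff, mem_singleton_iff, forall_eq_or_imp, forall_eq]
  exact ⟨main _, main _, main _⟩

theorem coord_one_nonneg_of_triangle (hS : IsPolygonWithBoundary S P) {i : Fin n}
    (h3 : ∀ k, k = i ∨ k = i + 1 ∨ k = i - 1) {x : Plane} (hx : x ∈ convexHull ℝ S) :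
    0 ≤ (cornerBasis hS.simple.nondegenerate i).coord 1 (x - P i) := by
  rw [convexHull_region_eq hS] at hx
  set f := (cornerBasis hS.simple.nondegenerate i).coord 1 with hf
  have hsub : convexHull ℝ (range P.vertices) ⊆ {x | f (P i) ≤ f x} := by
    apply convexHull_min _ (convex_halfSpace_ge f.isLinear _)
    rintro _ ⟨k, rfl⟩
    have e0 : f (P (i + 1) - P i) = 0 := by
      rw [← cornerBasis_zero hS.simple.nondegenerate]
      simp [hf]
    have e1 : f (P (i - 1) - P i) = 1 := by
      rw [← cornerBasis_one hS.simple.nondegenerate]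
      simp [hf]
    rw [map_sub] at e0 e1
    rcases h3 k with rfl | rfl | rfl <;> simp only [mem_ofPred_eq] <;> linarith
  rw [map_sub, sub_nonneg]
  exact hsub hx

/-- A polygon with three sides is convex. -/
theorem convex_of_triangle (hS : IsPolygonWithBoundary S P)
    (h3 : ∀ i k : Fin n, k = i ∨ k = i + 1 ∨ k = i - 1) : Convex ℝ S := by
  have hT := convex_convexHull ℝ S
  -- Each side lies on a supporting line of the hull. Hence the connected interior of the hull
  -- misses the frontier of `S` and lies in `S`.
  have hd : Disjoint (interior (convexHull ℝ S)) (frontier S) := by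
    rw [disjoint_left, hS.frontier_eq]
    intro x hx hb
    obtain ⟨i, hi⟩ := mem_iUnion.1 hb
    rw [edgeSet_eq_segment, segment_eq_image'] at hi
    obtain ⟨t, -, rfl⟩ := hi
    obtain ⟨δ, h1, h2⟩ := ((eventually_add_smul_mem isOpen_interior hx
      (-(P (i - 1) - P i))).and self_mem_nhdsWithin).exists
    have h4 := coord_one_nonneg_of_triangle hS (h3 i) (interior_subset h1)
    have h2' : (0 : ℝ) < δ := h2
    rw [← cornerBasis_zero hS.simple.nondegenerate, ← cornerBasis_one hS.simple.nondegenerate,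
      add_assoc, add_sub_cancel_left] at h4
    simp at h4
    linarith
  have hne : (interior S).Nonempty := by
    rw [nonempty_iff_ne_empty]
    intro h0
    have := hS.closure_interior
    rw [h0, closure_empty] at this
    have h1 := vertex_mem hS 0
    rw [← this] at h1
    exact h1
  have hmono : interior S ⊆ interior (convexHull ℝ S) := interior_mono (subset_convexHull ℝ S)
  have hsub := hT.interior.isPreconnected.subset_interior_of_disjoint_frontier hd
    (hne.mono fun x hx => ⟨hmono hx, interior_subset hx⟩)
  have hcl := hT.closure_interior_eq_closure_of_nonempty_interior (hne.mono hmono)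
  have : convexHull ℝ S = S := by
    apply Subset.antisymm _ (subset_convexHull ℝ S)
    calc convexHull ℝ S ⊆ closure (convexHull ℝ S) := subset_closure
      _ = closure (interior (convexHull ℝ S)) := hcl.symm
      _ ⊆ closure (interior S) := closure_mono hsub
      _ = S := hS.closure_interior
  rwa [← this]

/-- A concave polygon has two nonadjacent vertices that are extreme points of its convex hull. -/
theorem exists_nonadjacent_extreme_vertices (hS : IsPolygonWithBoundary S P)
    (hc : ¬ Convex ℝ S) :
    ∃ i j : Fin n, P i ∈ (convexHull ℝ S).extremePoints ℝ ∧
      P j ∈ (convexHull ℝ S).extremePoints ℝ ∧ i ≠ j ∧ j ≠ i + 1 ∧ i ≠ j + 1 := by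
  by_contra! hadj
  have hn := hS.simple.nondegenerate.three_le
  -- There are at least three extreme vertices, as otherwise `S` would lie in a segment. If all are
  -- pairwise adjacent, the cycle has length 3 and `S` is a triangle.
  have ex : ∀ i j : Fin n, ∃ k, P k ∈ (convexHull ℝ S).extremePoints ℝ ∧ k ≠ i ∧ k ≠ j := by
    intro i j
    by_contra! h
    refine not_region_subset_segment hS i j (region_subset_segment hS fun k hk => ?_)
    by_contra! h'
    exact h'.2 (h k hk h'.1)
  have n1 := Fin.one_ne_zero_of_three_le hn
  have n2 := Fin.one_add_one_ne_zero_of_three_le hn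
  have main : ∀ i, P i ∈ (convexHull ℝ S).extremePoints ℝ →
      P (i + 1) ∈ (convexHull ℝ S).extremePoints ℝ → False := by
    intro i hi hi'
    obtain ⟨k, hk, k1, k2⟩ := ex i (i + 1)
    have h1 : i = k + 1 := hadj i k hi hk k1.symm k2
    have h2 : k = i + 1 + 1 := by
      by_contra h
      exact k1 (add_right_cancel (hadj _ _ hi' hk k2.symm h)).symm
    have h3 : (1 + 1 + 1 : Fin n) = 0 := by
      have : i + (1 + 1 + 1) = i + 0 := by
        rw [add_zero]
        nth_rewrite 2 [h1]
        rw [h2]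
        abel
      exact add_left_cancel this
    have hn3 : n = 3 := by
      by_contra h
      exact Fin.one_add_one_add_one_ne_zero_of_four_le (by omega) h3
    subst hn3
    apply hc
    exact convex_of_triangle hS Fin.eq_or_eq_add_one_or_eq_sub_one
  obtain ⟨i, hi, -⟩ := ex 0 0
  obtain ⟨j, hj, hji, -⟩ := ex i i
  by_cases h : j = i + 1
  · exact main i hi (h ▸ hj)
  · have h1 : i = j + 1 := hadj i j hi hj hji.symm h
    exact main j hj (h1 ▸ hi)

theorem exists_indecomposable_of_concave (hS : IsPolygonWithBoundary S P) (hc : ¬ Convex ℝ S)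
    (hP : HasNoParallelSides P) (m : ℕ) :
    ∃ 𝒞 : Set (Set Plane),
      (∀ D ∈ 𝒞, IsHomotheticCopy S D) ∧ IsFoldCovering m 𝒞 ∧ ¬ IsDecomposable 𝒞 := by
  obtain ⟨i, j, hi, hj, hij, h1, h2⟩ := exists_nonadjacent_extreme_vertices hS hc
  have notMem : ∀ x ∈ (convexHull ℝ S).extremePoints ℝ, x ∉ interior (convexHull ℝ S) :=
    fun x hx hx' => disjoint_left.1 (disjoint_interior_extremePoints _) hx' hx
  refine exists_indecomposable_of_corners hS hij (notMem _ hi) (notMem _ hj) ?_ m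
  rintro e e' he he' ⟨c, h⟩ ⟨c', h'⟩
  have hd : P j - P i ≠ 0 := sub_ne_zero.2 fun h => hij (hS.simple.injective h).symm
  refine hP e e' ?_ (parallel_of_smul_eq hd h h')
  -- A side common to both corners would make `i` and `j` equal or adjacent.
  rintro rfl
  rcases he with rfl | rfl <;> rcases he' with h | h
  · exact hij h
  · exact h1 (by rw [h]; abel)
  · exact h2 (by rw [← h]; abel)
  · exact hij (sub_left_injective h)

end PolygonGeometry

theorem theorem1 (n : ℕ) [NeZero n] (P : Polygon Plane n) (S : Set Plane)
    (hS : IsPolygonWithBoundary S P)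
    (h : (Convex ℝ S ∧ 4 ≤ n) ∨ (¬ Convex ℝ S ∧ HasNoParallelSides P))
    (m : ℕ) (hm : 0 < m) :
    ∃ 𝒞 : Set (Set Plane),
      (∀ C ∈ 𝒞, IsHomotheticCopy S C) ∧ IsFoldCovering m 𝒞 ∧ ¬ IsDecomposable 𝒞 := by
  rcases h with ⟨hc, hn⟩ | ⟨hc, hP⟩
  · exact exists_indecomposable_of_convex hS hc hn m
  · exact exists_indecomposable_of_concave hS hc hP m
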